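/- **Two-sample voting.** Let $G$ be a $d$-regular simple graph on $n$ vertices, $d\ge 1$, in which each vertex has opinion $A$ or $B$; let $A$ and $B$ also denote the sets of vertices with these opinions. In each step all vertices simultaneously and independently draw two random neighbours (either with replacement, or without replacement; the result below holds for both variants). A vertex whose two samples have the same opinion adopts that opinion; otherwise it keeps its own. The initial imbalance is $\nu_0=(|A|-|B|)/n$. **Adversary.** An adaptive adversary knows the graph, the current opinions and the whole past, and chooses the initial placement of the opinions. At the beginning of each step it may redistribute the opinions arbitrarily among the vertices (keeping the number of vertices with each opinion), and then change the opinions of at most $f$ vertices. (In particular this covers an adversary who changes the opinions of at most $f$ vertices during the whole run, and one who keeps corrupting a fixed set of at most $f$ vertices.) **Corollary (robustness).** There are absolute constants $K,C>0$, independent of $d$, of the graph and of the adversary, such that the following hold. All asymptotics and "with high probability" (with probability tending to $1$) are along arbitrary sequences of instances with $n\to\infty$. 1. (Random regular graphs.) Let $G$ be uniformly distributed over all $d$-regular graphs on $n$ labelled vertices, where $d=d(n)\ge1$ is arbitrary such that there are such graphs. Suppose the adversary, who may choose the initial placement and its strategy depending on $G$, starts with imbalance $$\nu_0\ \ge\ K\sqrt{\frac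 dn+\frac1d},$$ and $f=o(\nu_0 n)$. Then with high probability (over $G$ and the voting) there is a time $t\le C\log n$ such that after step $t$ all but at most $Cf$ vertices have opinion $A$. 2. (Expanders.) Let $G$ be any $d$-regular $n$-vertex graph, and let $\lambda_G=\max\{\lambda_2,|\lambda_n|\}$, where $\lambda_1\ge\lambda_2\ge\dots\ge\lambda_n$ are the eigenvalues of the transition matrix $\frac1d\,\mathrm{Adj}(G)$ of the random walk on $G$. Suppose $$\nu_0\ \ge\ K\lambda_G,\qquad \nu_0\sqrt n\to\infty,$$ and $f=o(\nu_0 n)$. Then with high probability there is a time $t\le C\log n$ such that after step $t$ all but at most $Cf$ vertices have opinion $A$. -/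

import Mathlib

open Filter Topology Asymptotics

/-- How a vertex draws its two random neighbours: independently with replacement,
or as a uniformly random ordered pair of distinct neighbours. -/
inductive Sampling where
  | withReplacement
  | withoutReplacement

open Classical in
/-- The ordered pairs of neighbours that the vertex `v` may draw in one step. -/
noncomputable def samplePairs {V : Type} [Fintype V] (s : Sampling) (G : SimpleGraph V) (v : V) :
    Finset (V × V) :=
  match s with
  | .withReplacement => G.neighborFinset v ×ˢ G.neighborFinset v
  | .withoutReplacement => (G.neighborFinset v).offDiag

open Classical in
/-- All joint choices of one step: every vertex `v` draws the pair `c v` of its neighbours.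
The uniform distribution on this set makes the draws of the vertices independent and uniform. -/
noncomputable def jointSamples {V : Type} [Fintype V] (s : Sampling) (G : SimpleGraph V) :
    Finset (V → V × V) :=
  Fintype.piFinset (samplePairs s G)

open Classical in
/-- The two-sample rule. Opinions are described by the set `A` of the vertices with opinion `A`
(all the others have opinion `B`). A vertex whose two samples agree adopts their common opinion,
and otherwise it keeps its own. -/
noncomputable def updateOpinions {V : Type} [Fintype V] (A : Finset V) (c : V → V × V) :
    Finset V :=
  Finset.univ.filter fun v =>
    if ((c v).1 ∈ A ↔ (c v).2 ∈ A) then (c v).1 ∈ A else v ∈ A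

open Classical in
/-- The law of the opinions after one synchronous voting step started from the opinions `A`.
(If some vertex cannot draw a pair of neighbours at all, nothing happens.) -/
noncomputable def votingStep {V : Type} [Fintype V] (s : Sampling) (G : SimpleGraph V)
    (A : Finset V) : PMF (Finset V) :=
  if h : (jointSamples s G).Nonempty then
    (PMF.uniformOfFinset (jointSamples s G) h).map (updateOpinions A)
  else PMF.pure A

open Classical in
/-- `A'` can be produced from `A` by first redistributing the opinions arbitrarily among the
vertices, without changing the number of vertices with each opinion, and then changing the
opinions of at most `f` vertices. -/
def AdversaryCan {V : Type} (f : ℕ) (A A' : Finset V) : Prop :=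
  ∃ R : Finset V, R.card = A.card ∧ (symmDiff R A').card ≤ f

/-- An adaptive adversary. At the beginning of each voting step it sees the current opinions `A`
and the whole past `h` (most recent opinions first), and replaces `A` by `move h A`. -/
structure Adversary (V : Type) (f : ℕ) where
  move : List (Finset V) → Finset V → Finset V
  allowed : ∀ h A, AdversaryCan f A (move h A)

/-- The law, after `t` steps, of the pair consisting of the current opinions and the list of the
opinions after all the earlier steps (most recent first, down to the initial opinions `A₀`). In
each step the adversary moves first, and then all the vertices vote. -/
noncomputable def votingRun {V : Type} [Fintype V] {f : ℕ} (s : Sampling) (G : SimpleGraph V)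
    (σ : Adversary V f) (A₀ : Finset V) : ℕ → PMF (Finset V × List (Finset V))
  | 0 => PMF.pure (A₀, [])
  | t + 1 => (votingRun s G σ A₀ t).bind fun x =>
      (votingStep s G (σ.move x.2 x.1)).map fun A => (A, x.1 :: x.2)

open Classical in
/-- The runs in which at some time, up to the present, all but at most `m` vertices
have opinion `A`. -/
def almostAllAdopted {V : Type} [Fintype V] (m : ℝ) : Set (Finset V × List (Finset V)) :=
  {x | ∃ A ∈ x.1 :: x.2, ((Aᶜ.card : ℕ) : ℝ) ≤ m}

open Classical in
/-- The imbalance `(|A| - |B|) / n`, where `B` is the complement of `A`. -/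
noncomputable def imbalance {V : Type} [Fintype V] (A : Finset V) : ℝ :=
  ((A.card : ℝ) - (Aᶜ.card : ℝ)) / (Fintype.card V : ℝ)

open Classical in
/-- Every vertex has degree `d`. -/
def IsDRegular {V : Type} [Fintype V] (G : SimpleGraph V) (d : ℕ) : Prop :=
  G.IsRegularOfDegree d

open Classical in
/-- The set of all `d`-regular (simple) graphs with vertex set `{0, …, n - 1}`. -/
noncomputable def regularGraphs (n d : ℕ) : Finset (SimpleGraph (Fin n)) :=
  Finset.univ.filter fun G => IsDRegular G d

open Classical in
/-- The transition matrix `(1/d) A` of the random walk on a `d`-regular graph. -/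
noncomputable def transitionMatrix {V : Type} [Fintype V] (G : SimpleGraph V) (d : ℕ) :
    Matrix V V ℝ :=
  (1 / (d : ℝ)) • G.adjMatrix ℝ

theorem transitionMatrix_isHermitian {V : Type} [Fintype V] (G : SimpleGraph V) (d : ℕ) :
    (transitionMatrix G d).IsHermitian := by
  classical
  ext i j
  simp [transitionMatrix, SimpleGraph.adjMatrix_apply, SimpleGraph.adj_comm]

open Classical in
/-- `max {λ₂, |λₙ|}`, where `λ₁ ≥ λ₂ ≥ ⋯ ≥ λₙ` are the eigenvalues, with multiplicity, of the
transition matrix (`eigenvalues₀` lists them in decreasing order, starting from the index 0).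
For `n < 2` the value is irrelevant. -/
noncomputable def secondEigenvalue {V : Type} [Fintype V] (G : SimpleGraph V) (d : ℕ) : ℝ :=
  if h : 2 ≤ Fintype.card V then
    max ((transitionMatrix_isHermitian G d).eigenvalues₀ ⟨1, by omega⟩)
      |(transitionMatrix_isHermitian G d).eigenvalues₀ ⟨Fintype.card V - 1, by omega⟩|
  else 0

/-! Redistribution by the adversary is harmless once the drift of `|B|` is bounded uniformly over
all sets of a given size. Two deterministic properties of the graph achieve this.

`IsMixing G d ε` compares a step with the complete graph: the density `b` of `B` has next mean at
most `3b² - 2b³ + 2ε + 2/d` (`sum_lossProb_le_of_isMixing`). Without the errors the imbalance `ν`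
becomes `ν(3 - ν²)/2`, a gain by a constant factor while `ν ≤ 1 - θ`. If `ε`, `1/d` and `f/n` are at
most a small multiple `κν` of `ν`, then `ν` still grows by the factor `1 + κ` (`density_step`). The
draws are independent, so a step fails with probability at most `exp(-cν²n)`. As `ν` grows
geometrically, these failures add up to `O(1/(ν₀²n))`, which vanishes because `ν₀√n → ∞`.

When `B` is small, the additive errors of mixing would dominate, and `IsSpreading` takes over: the
mean of `|B|` after a vote is at most a quarter of its size before the vote. As long as `|B| > Cf ≥
f`, the adversary at most doubles `|B|` before the vote, so `|B|` still halves on average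
(`failProb_le_of_few`). Both phases take `O(log n)` steps.

For random regular graphs, double counting of switchings bounds the exponential moments of edge
counts as for a Poisson variable (`sum_exp_edgeWeight_le`). A union bound over pairs of sets gives
mixing with `ε` of order `d/n + 1/√d`; a union bound over small sets gives sparseness, hence
spreading (`IsSparse.isSpreading`). Since `ν₀ ≤ 1`, the hypothesis on `ν₀` already forces `d ≥ K`
and `n ≥ Kd`, so very small and very large degrees do not arise. For expanders both properties
follow from the spectral bound `sum_sq_nbrFrac_sub_le`. -/

/-! ### Switchings of regular graphs. -/

/-- `G - uv - xy + ux + vy`. -/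
def switchGraph {V : Type} (G : SimpleGraph V) (u v x y : V) : SimpleGraph V :=
  SimpleGraph.fromEdgeSet ((G.edgeSet \ {s(u, v), s(x, y)}) ∪ {s(u, x), s(v, y)})

/-- The switching `uv, xy ↦ ux, vy` can be applied to `G`. -/
def CanSwitch {V : Type} (G : SimpleGraph V) (u v x y : V) : Prop :=
  G.Adj u v ∧ G.Adj x y ∧ u ≠ x ∧ ¬ G.Adj u x ∧ v ≠ y ∧ ¬ G.Adj v y

theorem switchGraph_adj {V : Type} {G : SimpleGraph V} {u v x y : V} (h : CanSwitch G u v x y)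
    (a b : V) : (switchGraph G u v x y).Adj a b ↔
      (G.Adj a b ∧ ¬ (a = u ∧ b = v ∨ a = v ∧ b = u) ∧ ¬ (a = x ∧ b = y ∨ a = y ∧ b = x)) ∨
        (a = u ∧ b = x ∨ a = x ∧ b = u) ∨ (a = v ∧ b = y ∨ a = y ∧ b = v) := by
  obtain ⟨h1, h2, h3, h4, h5, h6⟩ := h
  have : G.Adj a b → a ≠ b := fun h => h.ne
  simp only [switchGraph, SimpleGraph.fromEdgeSet_adj, Set.mem_union, Set.mem_sdiff,
    SimpleGraph.mem_edgeSet, Set.mem_insert_iff, Set.mem_singleton_iff, Sym2.eq_iff]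
  grind

/-- Undoing a switching is again a switching, with the roles of `v` and `x` exchanged. This symmetry
makes the double counting below an involution. -/
theorem CanSwitch.switch {V : Type} {G : SimpleGraph V} {u v x y : V} (h : CanSwitch G u v x y) :
    CanSwitch (switchGraph G u v x y) u x v y := by
  have h' := h
  obtain ⟨h1, h2, h3, h4, h5, h6⟩ := h
  have e1 := h1.ne
  have e2 := h2.ne
  have e3 := h1.symm
  have e4 := h2.symm
  have e5 := G.adj_comm u x
  have e6 := G.adj_comm v y
  simp only [CanSwitch, switchGraph_adj h']
  grind

theorem switchGraph_switchGraph {V : Type} {G : SimpleGraph V} {u v x y : V}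
    (h : CanSwitch G u v x y) : switchGraph (switchGraph G u v x y) u x v y = G := by
  ext a b
  rw [switchGraph_adj h.switch, switchGraph_adj h]
  obtain ⟨h1, h2, h3, h4, h5, h6⟩ := h
  have e1 := h1.ne
  have e2 := h2.ne
  have e3 := h1.symm
  have e4 := h2.symm
  have hs := G.adj_comm a b
  grind

open Classical in
/-- The indicator of adjacency. -/
noncomputable def adjInd {V : Type} (G : SimpleGraph V) (a b : V) : ℝ := if G.Adj a b then 1 else 0

open Classical in
/-- The indicator of the two orientations of the pair `uv`. -/
noncomputable def pairInd {V : Type} (u v a b : V) : ℝ :=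
  (if a = u then (if b = v then 1 else 0) else 0) + (if a = v then (if b = u then 1 else 0) else 0)

theorem adjInd_switchGraph {V : Type} {G : SimpleGraph V} {u v x y : V}
    (h : CanSwitch G u v x y) (a b : V) : adjInd (switchGraph G u v x y) a b =
      adjInd G a b - pairInd u v a b - pairInd x y a b + pairInd u x a b + pairInd v y a b := by
  classical
  simp only [adjInd, pairInd, switchGraph_adj h]
  obtain ⟨h1, h2, h3, h4, h5, h6⟩ := h
  have e1 := h1.ne
  have e2 := h2.ne
  have e3 := h1.symm
  have e4 := h2.symm
  have hs := G.adj_comm a b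
  grind

theorem adjInd_nonneg {V : Type} (G : SimpleGraph V) (a b : V) : 0 ≤ adjInd G a b := by
  unfold adjInd; split_ifs <;> norm_num

theorem adjInd_comm {V : Type} (G : SimpleGraph V) (a b : V) : adjInd G a b = adjInd G b a := by
  classical
  unfold adjInd; congr 1; rw [G.adj_comm]

open Classical in
/-- The indicator of `CanSwitch`. -/
noncomputable def switchInd (G : SimpleGraph V) (u v x y : V) : ℝ :=
  if CanSwitch G u v x y then 1 else 0

theorem switchInd_nonneg (G : SimpleGraph V) (u v x y : V) : 0 ≤ switchInd G u v x y := by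
  unfold switchInd; split_ifs <;> norm_num

theorem switchInd_le (G : SimpleGraph V) (u v x y : V) :
    switchInd G u v x y ≤ adjInd G u v * adjInd G x y := by
  classical
  unfold switchInd adjInd CanSwitch
  split_ifs <;> grind

-- A union bound over the four obstructions to switching two given edges.
open Classical in
theorem le_switchInd (G : SimpleGraph V) (u v x y : V) :
    adjInd G u v * adjInd G x y - adjInd G u v * adjInd G x y * (adjInd G u x + adjInd G v y
      + (if u = x then 1 else 0) + (if v = y then 1 else 0))
      ≤ switchInd G u v x y := by
  unfold switchInd adjInd CanSwitch
  split_ifs <;> grind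

section
variable {V : Type} [Fintype V]

theorem sum_mul_pairInd (w : V → V → ℝ) (u v : V) :
    ∑ a, ∑ b, w a b * pairInd u v a b = w u v + w v u := by
  classical
  simp only [pairInd, mul_add, Finset.sum_add_distrib]
  simp [mul_ite]

theorem sum_pairInd (u v a : V) :
    ∑ b, pairInd u v a b = (open Classical in (if a = u then 1 else 0) + if a = v then 1 else 0) := by
  classical
  simp only [pairInd, Finset.sum_add_distrib]
  split_ifs <;> simp

theorem isDRegular_iff (G : SimpleGraph V) (d : ℕ) :
    IsDRegular G d ↔ ∀ a, ∑ b, adjInd G a b = d := by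
  classical
  unfold IsDRegular SimpleGraph.IsRegularOfDegree
  refine forall_congr' fun a => ?_
  have : ∑ b, adjInd G a b = (((Finset.univ.filter fun b => G.Adj a b).card : ℕ) : ℝ) := by
    simp [adjInd, Finset.sum_boole]
  rw [this, ← SimpleGraph.card_neighborFinset_eq_degree, SimpleGraph.neighborFinset_eq_filter]
  norm_cast

theorem IsDRegular.switch {G : SimpleGraph V} {d : ℕ} (hG : IsDRegular G d) {u v x y : V}
    (h : CanSwitch G u v x y) : IsDRegular (switchGraph G u v x y) d := by
  rw [isDRegular_iff] at hG ⊢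
  intro a
  simp only [adjInd_switchGraph h, Finset.sum_add_distrib, Finset.sum_sub_distrib, hG,
    sum_pairInd]
  ring

/-- The total weight of the ordered pairs of adjacent vertices. -/
noncomputable def edgeWeight (w : V → V → ℝ) (G : SimpleGraph V) : ℝ :=
  ∑ a, ∑ b, w a b * adjInd G a b

theorem edgeWeight_switchGraph (w : V → V → ℝ) {G : SimpleGraph V} {u v x y : V}
    (h : CanSwitch G u v x y) : edgeWeight w (switchGraph G u v x y) =
      edgeWeight w G - (w u v + w v u) - (w x y + w y x) + (w u x + w x u) + (w v y + w y v) := by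
  simp only [edgeWeight, adjInd_switchGraph h, mul_add, mul_sub, Finset.sum_add_distrib,
    Finset.sum_sub_distrib, sum_mul_pairInd]

/-- Only the two new edges can add weight, each in two orientations; this is the source of the
factor `exp (4 * θ)` below. -/
theorem edgeWeight_switchGraph_le {w : V → V → ℝ} (h0 : ∀ a b, 0 ≤ w a b) (h1 : ∀ a b, w a b ≤ 1)
    {G : SimpleGraph V} {u v x y : V} (h : CanSwitch G u v x y) :
    edgeWeight w (switchGraph G u v x y) ≤ edgeWeight w G + 4 := by
  rw [edgeWeight_switchGraph w h]
  linarith [h0 u v, h0 v u, h0 x y, h0 y x, h1 u x, h1 x u, h1 v y, h1 y v]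

/-- Once the new edge `ux` is fixed, `v` and `y` are neighbours of `u` and `x`, which leaves at most
`d ^ 2` switchings. -/
theorem sum_switchInd_le {G : SimpleGraph V} {d : ℕ} (hG : IsDRegular G d) {w : V → V → ℝ}
    (h0 : ∀ a b, 0 ≤ w a b) :
    ∑ u, ∑ v, ∑ x, ∑ y, w u x * switchInd G u v x y ≤ d ^ 2 * ∑ u, ∑ x, w u x := by
  rw [isDRegular_iff] at hG
  calc ∑ u, ∑ v, ∑ x, ∑ y, w u x * switchInd G u v x y
      ≤ ∑ u, ∑ v, ∑ x, ∑ y, w u x * (adjInd G u v * adjInd G x y) := by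
        gcongr with u _ v _ x _ y _
        · exact h0 u x
        · exact switchInd_le G u v x y
    _ = ∑ u, ∑ v, ∑ x, w u x * (adjInd G u v * d) := by
        simp only [← Finset.mul_sum, hG]
    _ = ∑ u, ∑ x, ∑ v, w u x * (adjInd G u v * d) :=
        Finset.sum_congr rfl fun u _ => Finset.sum_comm
    _ = d ^ 2 * ∑ u, ∑ x, w u x := by
        simp only [← Finset.mul_sum, ← Finset.sum_mul, hG]
        ring

/-- Of the `n * d` oriented edges `xy`, at most `d ^ 2` are lost to each of the adjacencies `ux`,
`vy`, and at most `d` to each of the equalities `u = x`, `v = y`. -/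
theorem le_sum_switchInd {G : SimpleGraph V} {d : ℕ} (hG : IsDRegular G d) (u v : V) :
    adjInd G u v * ((Fintype.card V : ℝ) * d - 2 * d * (d + 1))
      ≤ ∑ x, ∑ y, switchInd G u v x y := by
  classical
  rw [isDRegular_iff] at hG
  have hG' : ∀ y, ∑ x, adjInd G x y = d := fun y => by simp only [adjInd_comm G _ y, hG]
  calc adjInd G u v * ((Fintype.card V : ℝ) * d - 2 * d * (d + 1))
      = ∑ x, ∑ y, (adjInd G u v * adjInd G x y - adjInd G u v * adjInd G x y *
        (adjInd G u x + adjInd G v y + (if u = x then 1 else 0) + (if v = y then 1 else 0))) := by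
        have e1 : ∑ x, ∑ y, adjInd G x y = Fintype.card V * d := by simp [hG]
        have e2 : ∑ x, ∑ y, adjInd G x y * adjInd G u x = d * d := by
          simp only [← Finset.sum_mul, ← Finset.mul_sum, hG]
        have e3 : ∑ x, ∑ y, adjInd G x y * adjInd G v y = d * d := by
          rw [Finset.sum_comm]
          simp only [← Finset.sum_mul, ← Finset.mul_sum, hG, hG']
        have e4 : ∑ x, ∑ y, adjInd G x y * (if u = x then 1 else 0) = d := by
          simp only [← Finset.sum_mul, hG]; simp
        have e5 : ∑ x, ∑ y, adjInd G x y * (if v = y then 1 else 0) = d := by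
          rw [Finset.sum_comm]; simp only [← Finset.sum_mul, hG']; simp
        simp only [mul_assoc, ← Finset.mul_sum, Finset.sum_sub_distrib, mul_add,
          Finset.sum_add_distrib, e1, e2, e3, e4, e5]
        ring
    _ ≤ _ := by
        gcongr with x _ y _
        exact le_switchInd G u v x y

theorem le_sum_mul_switchInd {G : SimpleGraph V} {d : ℕ} (hG : IsDRegular G d) {w : V → V → ℝ}
    (h0 : ∀ a b, 0 ≤ w a b) :
    ((Fintype.card V : ℝ) * d - 2 * d * (d + 1)) * edgeWeight w G
      ≤ ∑ u, ∑ v, ∑ x, ∑ y, w u v * switchInd G u v x y := by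
  rw [edgeWeight, Finset.mul_sum]
  gcongr with u _
  rw [Finset.mul_sum]
  gcongr with v _
  simp only [← Finset.mul_sum]
  calc _ = w u v * (adjInd G u v * ((Fintype.card V : ℝ) * d - 2 * d * (d + 1))) := by ring
    _ ≤ _ := mul_le_mul_of_nonneg_left (le_sum_switchInd hG u v) (h0 u v)
end

theorem mem_regularGraphs {n d : ℕ} {G : SimpleGraph (Fin n)} :
    G ∈ regularGraphs n d ↔ IsDRegular G d := by
  simp [regularGraphs]

/-! ### Exponential moments of edge counts. -/

/-- Double counting of the pairs of a graph and a switching. -/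
theorem sum_switch_comm {n d : ℕ} (Φ : SimpleGraph (Fin n) → Fin n → Fin n → ℝ) :
    ∑ G ∈ regularGraphs n d, ∑ u, ∑ v, ∑ x, ∑ y, Φ G u v * switchInd G u v x y =
      ∑ G ∈ regularGraphs n d, ∑ u, ∑ v, ∑ x, ∑ y,
        Φ (switchGraph G u v x y) u x * switchInd G u v x y := by
  classical
  let S : Finset (SimpleGraph (Fin n) × Fin n × Fin n × Fin n × Fin n) :=
    (regularGraphs n d ×ˢ Finset.univ).filter
      fun p => CanSwitch p.1 p.2.1 p.2.2.1 p.2.2.2.1 p.2.2.2.2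
  have key : ∀ Ψ : SimpleGraph (Fin n) → Fin n → Fin n → Fin n → Fin n → ℝ,
      ∑ G ∈ regularGraphs n d, ∑ u, ∑ v, ∑ x, ∑ y, Ψ G u v x y * switchInd G u v x y =
        ∑ p ∈ S, Ψ p.1 p.2.1 p.2.2.1 p.2.2.2.1 p.2.2.2.2 := by
    intro Ψ
    rw [Finset.sum_filter, Finset.sum_product]
    refine Finset.sum_congr rfl fun G _ => ?_
    simp only [Fintype.sum_prod_type, switchInd, mul_ite, mul_one, mul_zero]
  rw [key fun G u v _ _ => Φ G u v, key fun G u v x y => Φ (switchGraph G u v x y) u x]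
  -- The map (graph, `u v x y`) ↦ (switched graph, `u x v y`) preserves `S` and is its own inverse,
  -- so it serves as both directions of the bijection.
  have hmem : ∀ p ∈ S, (switchGraph p.1 p.2.1 p.2.2.1 p.2.2.2.1 p.2.2.2.2, p.2.1, p.2.2.2.1,
      p.2.2.1, p.2.2.2.2) ∈ S := by
    rintro ⟨G, u, v, x, y⟩ hp
    simp only [S, Finset.mem_filter, Finset.mem_product, Finset.mem_univ, and_true,
      mem_regularGraphs] at hp ⊢
    exact ⟨hp.1.switch hp.2, hp.2.switch⟩
  refine Finset.sum_nbij'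
    (fun p => (switchGraph p.1 p.2.1 p.2.2.1 p.2.2.2.1 p.2.2.2.2, p.2.1, p.2.2.2.1,
      p.2.2.1, p.2.2.2.2))
    (fun p => (switchGraph p.1 p.2.1 p.2.2.1 p.2.2.2.1 p.2.2.2.2, p.2.1, p.2.2.2.1,
      p.2.2.1, p.2.2.2.2)) hmem hmem ?_ ?_ ?_
  all_goals
    rintro ⟨G, u, v, x, y⟩ hp
    simp only [S, Finset.mem_filter] at hp
    simp [switchGraph_switchGraph hp.2]

/-- Graphs of large weight are rare among the switchings. -/
theorem sum_edgeWeight_mul_exp_le {n d : ℕ} {w : Fin n → Fin n → ℝ}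
    (h0 : ∀ a b, 0 ≤ w a b) (h1 : ∀ a b, w a b ≤ 1) {θ : ℝ} (hθ : 0 ≤ θ) :
    ((n : ℝ) * d - 2 * d * (d + 1)) *
        ∑ G ∈ regularGraphs n d, edgeWeight w G * Real.exp (θ * edgeWeight w G)
      ≤ Real.exp (4 * θ) * (d ^ 2 * ∑ u, ∑ x, w u x) *
        ∑ G ∈ regularGraphs n d, Real.exp (θ * edgeWeight w G) := by
  calc _ = ∑ G ∈ regularGraphs n d, (((n : ℝ) * d - 2 * d * (d + 1)) * edgeWeight w G) *
          Real.exp (θ * edgeWeight w G) := by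
        rw [Finset.mul_sum]
        exact Finset.sum_congr rfl fun G _ => by ring
    _ ≤ ∑ G ∈ regularGraphs n d, (∑ u, ∑ v, ∑ x, ∑ y, w u v * switchInd G u v x y) *
          Real.exp (θ * edgeWeight w G) := by
        gcongr with G hG
        simpa using le_sum_mul_switchInd (mem_regularGraphs.1 hG) h0
    _ = ∑ G ∈ regularGraphs n d, ∑ u, ∑ v, ∑ x, ∑ y,
          (w u v * Real.exp (θ * edgeWeight w G)) * switchInd G u v x y := by
        simp only [Finset.sum_mul]
        simp only [mul_right_comm]
    _ = ∑ G ∈ regularGraphs n d, ∑ u, ∑ v, ∑ x, ∑ y,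
          (w u x * Real.exp (θ * edgeWeight w (switchGraph G u v x y))) * switchInd G u v x y :=
        sum_switch_comm fun G u v => w u v * Real.exp (θ * edgeWeight w G)
    _ ≤ ∑ G ∈ regularGraphs n d, ∑ u, ∑ v, ∑ x, ∑ y,
          (w u x * switchInd G u v x y) * (Real.exp (4 * θ) * Real.exp (θ * edgeWeight w G)) := by
        refine Finset.sum_le_sum fun G _ => Finset.sum_le_sum fun u _ => Finset.sum_le_sum fun v _ =>
          Finset.sum_le_sum fun x _ => Finset.sum_le_sum fun y _ => ?_
        by_cases h : CanSwitch G u v x y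
        · rw [mul_right_comm (w u x), ← Real.exp_add]
          refine mul_le_mul_of_nonneg_left (Real.exp_le_exp.2 ?_)
            (mul_nonneg (h0 _ _) (switchInd_nonneg _ _ _ _ _))
          nlinarith [edgeWeight_switchGraph_le h0 h1 h]
        · simp [switchInd, h]
    _ = ∑ G ∈ regularGraphs n d, (∑ u, ∑ v, ∑ x, ∑ y, w u x * switchInd G u v x y) *
          (Real.exp (4 * θ) * Real.exp (θ * edgeWeight w G)) := by
        simp only [Finset.sum_mul]
    _ ≤ ∑ G ∈ regularGraphs n d, (d ^ 2 * ∑ u, ∑ x, w u x) *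
          (Real.exp (4 * θ) * Real.exp (θ * edgeWeight w G)) := by
        gcongr with G hG
        exact sum_switchInd_le (mem_regularGraphs.1 hG) h0
    _ = _ := by
        rw [← Finset.mul_sum, ← Finset.mul_sum]
        ring

/-- A Poisson-type bound for the exponential moments of the weight of a random regular graph. -/
theorem sum_exp_edgeWeight_le {n d : ℕ} {w : Fin n → Fin n → ℝ}
    (h0 : ∀ a b, 0 ≤ w a b) (h1 : ∀ a b, w a b ≤ 1) {α : ℝ}
    (hpos : 0 < (n : ℝ) * d - 2 * d * (d + 1))
    (hα : d ^ 2 * ∑ u, ∑ x, w u x ≤ α * ((n : ℝ) * d - 2 * d * (d + 1))) {θ : ℝ} (hθ : 0 ≤ θ) :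
    ∑ G ∈ regularGraphs n d, Real.exp (θ * edgeWeight w G) ≤
      (regularGraphs n d).card * Real.exp (α * (Real.exp (4 * θ) - 1) / 4) := by
  set m : ℝ → ℝ := fun θ => ∑ G ∈ regularGraphs n d, Real.exp (θ * edgeWeight w G) with hm
  set g : ℝ → ℝ := fun θ => m θ * Real.exp (-(α * (Real.exp (4 * θ) - 1) / 4)) with hg
  have hmd : ∀ θ, HasDerivAt m
      (∑ G ∈ regularGraphs n d, edgeWeight w G * Real.exp (θ * edgeWeight w G)) θ := by
    intro θ
    refine HasDerivAt.fun_sum fun G _ => ?_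
    have := ((hasDerivAt_id θ).mul_const (edgeWeight w G)).exp
    simpa [mul_comm] using this
  have hed : ∀ θ, HasDerivAt (fun θ => Real.exp (-(α * (Real.exp (4 * θ) - 1) / 4)))
      (Real.exp (-(α * (Real.exp (4 * θ) - 1) / 4)) * (-(α * Real.exp (4 * θ)))) θ := by
    intro θ
    have h4 : HasDerivAt (fun θ : ℝ => Real.exp (4 * θ)) (Real.exp (4 * θ) * 4) θ := by
      simpa using ((hasDerivAt_id θ).const_mul 4).exp
    have := (((h4.sub_const 1).const_mul α).div_const 4).neg.exp
    refine this.congr_deriv ?_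
    simp only [Pi.neg_apply]
    ring
  have hgd : ∀ θ, HasDerivAt g _ θ := fun θ => (hmd θ).mul (hed θ)
  -- Double counting amounts to the differential inequality `m' ≤ α * exp (4θ) * m`; the second
  -- factor of `g` is the inverse of the solution of the corresponding equation.
  have hanti : AntitoneOn g (Set.Ici 0) := by
    refine antitoneOn_of_deriv_nonpos (convex_Ici 0)
      (fun θ _ => (hgd θ).continuousAt.continuousWithinAt)
      (fun θ _ => (hgd θ).differentiableAt.differentiableWithinAt) fun θ hθ => ?_
    rw [interior_Ici, Set.mem_Ioi] at hθ
    rw [(hgd θ).deriv]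
    have hkey := sum_edgeWeight_mul_exp_le (d := d) h0 h1 hθ.le
    have hm0 : 0 ≤ m θ := Finset.sum_nonneg fun G _ => (Real.exp_pos _).le
    have h2 : (∑ G ∈ regularGraphs n d, edgeWeight w G * Real.exp (θ * edgeWeight w G))
        ≤ Real.exp (4 * θ) * α * m θ := by
      refine le_of_mul_le_mul_left (hkey.trans ?_) hpos
      calc _ ≤ Real.exp (4 * θ) * (α * ((n : ℝ) * d - 2 * d * (d + 1))) * m θ := by gcongr
        _ = _ := by ring
    have h3 := mul_le_mul_of_nonneg_right h2
      (Real.exp_pos (-(α * (Real.exp (4 * θ) - 1) / 4))).le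
    linarith
  have h := hanti (Set.mem_Ici.2 le_rfl) (Set.mem_Ici.2 hθ) hθ
  have hz : g 0 = (regularGraphs n d).card := by simp [hg, hm]
  rw [hz] at h
  simp only [hg, Real.exp_neg] at h
  rwa [← div_eq_mul_inv, div_le_iff₀ (Real.exp_pos _)] at h

open Classical in
theorem card_filter_le_edgeWeight {n d : ℕ} {w : Fin n → Fin n → ℝ}
    (h0 : ∀ a b, 0 ≤ w a b) (h1 : ∀ a b, w a b ≤ 1) {α : ℝ}
    (hpos : 0 < (n : ℝ) * d - 2 * d * (d + 1))
    (hα : d ^ 2 * ∑ u, ∑ x, w u x ≤ α * ((n : ℝ) * d - 2 * d * (d + 1))) {θ : ℝ} (hθ : 0 ≤ θ)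
    (s : ℝ) :
    (((regularGraphs n d).filter fun G => s ≤ edgeWeight w G).card : ℝ) ≤
      (regularGraphs n d).card * Real.exp (α * (Real.exp (4 * θ) - 1) / 4 - θ * s) := by
  rw [Real.exp_sub, mul_div_assoc', le_div_iff₀ (Real.exp_pos _)]
  refine le_trans ?_ (sum_exp_edgeWeight_le h0 h1 hpos hα hθ)
  rw [← nsmul_eq_mul, ← Finset.sum_const]
  refine le_trans (Finset.sum_le_sum fun G hG => ?_) (Finset.sum_le_sum_of_subset_of_nonneg
    (Finset.filter_subset _ _) fun G _ _ => (Real.exp_pos _).le)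
  rw [Finset.mem_filter] at hG
  exact Real.exp_le_exp.2 (mul_le_mul_of_nonneg_left hG.2 hθ)

/-! ### Mixing, spreading and sparse graphs. -/

/-- The proportion of the neighbours of `v` that lie in `B`. -/
noncomputable def nbrFrac {V : Type} (G : SimpleGraph V) (d : ℕ) (B : Finset V) (v : V) : ℝ :=
  (∑ w ∈ B, adjInd G v w) / d

theorem nbrFrac_nonneg {V : Type} (G : SimpleGraph V) (d : ℕ) (B : Finset V) (v : V) :
    0 ≤ nbrFrac G d B v :=
  div_nonneg (Finset.sum_nonneg fun w _ => adjInd_nonneg G v w) d.cast_nonneg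

/-- The indicator of the rectangle `T × B`. -/
noncomputable def rectInd {V : Type} (T B : Finset V) (a b : V) : ℝ :=
  Set.indicator (T : Set V) 1 a * Set.indicator (B : Set V) 1 b

theorem rectInd_nonneg {V : Type} (T B : Finset V) (a b : V) : 0 ≤ rectInd T B a b := by
  classical
  simp only [rectInd, Set.indicator_apply]
  split_ifs <;> norm_num

theorem rectInd_le_one {V : Type} (T B : Finset V) (a b : V) : rectInd T B a b ≤ 1 := by
  classical
  simp only [rectInd, Set.indicator_apply]
  split_ifs <;> norm_num

section
variable {V : Type} [Fintype V]

/-- On average over the vertices, the proportion of neighbours in any set `B` is close to the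
density of `B`. -/
def IsMixing (G : SimpleGraph V) (d : ℕ) (ε : ℝ) : Prop :=
  ∀ B : Finset V, ∑ v, |nbrFrac G d B v - (B.card : ℝ) / Fintype.card V| ≤ ε * Fintype.card V

/-- Small sets of vertices have few common neighbours. -/
def IsSpreading (G : SimpleGraph V) (d : ℕ) (θ : ℝ) : Prop :=
  ∀ B : Finset V, (B.card : ℝ) ≤ θ * Fintype.card V →
    ∑ v, nbrFrac G d B v ^ 2 ≤ (B.card : ℝ) / 256

/-- Small sets of vertices span few edges. -/
def IsSparse (G : SimpleGraph V) (d : ℕ) (c η : ℝ) : Prop :=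
  ∀ U : Finset V, (U.card : ℝ) ≤ c * Fintype.card V →
    ∑ a ∈ U, ∑ b ∈ U, adjInd G a b ≤ η * d * U.card

theorem sum_adjInd_le {G : SimpleGraph V} {d : ℕ} (hG : IsDRegular G d) (B : Finset V) (v : V) :
    ∑ w ∈ B, adjInd G v w ≤ d := by
  rw [← (isDRegular_iff G d).1 hG v]
  exact Finset.sum_le_sum_of_subset_of_nonneg (Finset.subset_univ B) fun w _ _ =>
    adjInd_nonneg G v w

theorem nbrFrac_le_one {G : SimpleGraph V} {d : ℕ} (hG : IsDRegular G d) (B : Finset V) (v : V) :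
    nbrFrac G d B v ≤ 1 :=
  div_le_one_of_le₀ (sum_adjInd_le hG B v) d.cast_nonneg

theorem sum_nbrFrac {G : SimpleGraph V} {d : ℕ} (hd : 0 < d) (hG : IsDRegular G d)
    (B : Finset V) : ∑ v, nbrFrac G d B v = B.card := by
  have hd' : (d : ℝ) ≠ 0 := by positivity
  simp only [nbrFrac, ← Finset.sum_div]
  rw [Finset.sum_comm, div_eq_iff hd']
  simp_rw [adjInd_comm G _, (isDRegular_iff G d).1 hG]
  simp

theorem sum_indicator_mul (T : Finset V) (g : V → ℝ) :
    ∑ a, Set.indicator (T : Set V) (1 : V → ℝ) a * g a = ∑ a ∈ T, g a := by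
  classical
  simp [Set.indicator_apply]

theorem sum_rectInd (T B : Finset V) : ∑ a, ∑ b, rectInd T B a b = T.card * B.card := by
  have h := sum_indicator_mul B fun _ => 1
  have h' := sum_indicator_mul T fun _ => (B.card : ℝ)
  simp only [mul_one, Finset.sum_const, nsmul_eq_mul] at h h'
  simp only [rectInd, ← Finset.mul_sum, h, h']

theorem edgeWeight_rectInd (T B : Finset V) (G : SimpleGraph V) :
    edgeWeight (rectInd T B) G = ∑ a ∈ T, ∑ b ∈ B, adjInd G a b := by
  simp only [edgeWeight, rectInd, mul_assoc, ← Finset.mul_sum, sum_indicator_mul]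

/-- The deviations sum to zero, so their `ℓ¹` norm is twice their positive part. With `T` the
vertices of nonnegative deviation, mixing becomes a statement about edges between `T` and `B`. -/
theorem sum_abs_nbrFrac_sub {G : SimpleGraph V} {d : ℕ} (hd : 0 < d) (hG : IsDRegular G d)
    (B : Finset V) : ∃ T : Finset V,
      ∑ v, |nbrFrac G d B v - (B.card : ℝ) / Fintype.card V| =
        2 * (edgeWeight (rectInd T B) G / d - (T.card : ℝ) * B.card / Fintype.card V) := by
  classical
  set b : ℝ := (B.card : ℝ) / Fintype.card V with hb
  refine ⟨Finset.univ.filter fun v => b ≤ nbrFrac G d B v, ?_⟩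
  set T := Finset.univ.filter fun v => b ≤ nbrFrac G d B v with hT
  have h1 : edgeWeight (rectInd T B) G / d - (T.card : ℝ) * B.card / Fintype.card V =
      ∑ v ∈ T, (nbrFrac G d B v - b) := by
    rw [edgeWeight_rectInd, Finset.sum_sub_distrib, Finset.sum_div]
    simp only [nbrFrac, Finset.sum_const, nsmul_eq_mul, hb, mul_div_assoc]
  have h2 : ∑ v, (nbrFrac G d B v - b) = 0 := by
    rw [Finset.sum_sub_distrib, sum_nbrFrac hd hG]
    rcases isEmpty_or_nonempty V with h | h
    · simp [Finset.eq_empty_of_isEmpty B]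
    · simp [hb]
      field_simp
      simp
  rw [h1, ← sub_zero (2 * ∑ v ∈ T, _), ← h2, hT, Finset.sum_filter, Finset.mul_sum,
    ← Finset.sum_sub_distrib]
  refine Finset.sum_congr rfl fun v _ => ?_
  split_ifs with h
  · rw [abs_of_nonneg (by linarith)]; ring
  · rw [abs_of_neg (by linarith)]; ring

/-- Let `T` be the vertices with at least a proportion `1/512` of neighbours in `B`; by Markov `|B ∪
T| ≤ 513|B|`. Off `T` a square is at most `1/512` of the proportion itself; on `T` sparseness of `B
∪ T` bounds the sum. Each part contributes at most `|B|/512`. -/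
theorem IsSparse.isSpreading {G : SimpleGraph V} {d : ℕ} (hd : 0 < d) (hG : IsDRegular G d)
    {c : ℝ} (h : IsSparse G d c (1 / (512 * 513))) : IsSpreading G d (c / 513) := by
  classical
  intro B hB
  set T := Finset.univ.filter fun v => 1 / 512 ≤ nbrFrac G d B v with hT
  have hsum := sum_nbrFrac hd hG B
  have hd' : (0 : ℝ) < d := by positivity
  have hTc : (T.card : ℝ) ≤ 512 * B.card := by
    have : ∑ v ∈ T, (1 / 512 : ℝ) ≤ ∑ v, nbrFrac G d B v :=
      (Finset.sum_le_sum fun v hv => (Finset.mem_filter.1 hv).2).trans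
        (Finset.sum_le_sum_of_subset_of_nonneg (Finset.subset_univ _) fun v _ _ =>
          nbrFrac_nonneg G d B v)
    rw [hsum, Finset.sum_const, nsmul_eq_mul] at this
    linarith
  have hU : ((B ∪ T).card : ℝ) ≤ 513 * B.card := by
    have : ((B ∪ T).card : ℝ) ≤ B.card + T.card := by exact_mod_cast Finset.card_union_le B T
    linarith
  have hU' := h (B ∪ T) (by linarith)
  have hT2 : ∑ v ∈ T, nbrFrac G d B v ≤ (B.card : ℝ) / 512 := by
    simp only [nbrFrac, ← Finset.sum_div]
    rw [div_le_iff₀ hd']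
    calc ∑ a ∈ T, ∑ b ∈ B, adjInd G a b ≤ ∑ a ∈ B ∪ T, ∑ b ∈ B ∪ T, adjInd G a b := by
          refine (Finset.sum_le_sum fun a _ => Finset.sum_le_sum_of_subset_of_nonneg
            (Finset.subset_union_left (s₂ := T)) fun b _ _ => adjInd_nonneg G a b).trans
            (Finset.sum_le_sum_of_subset_of_nonneg Finset.subset_union_right fun a _ _ =>
              Finset.sum_nonneg fun b _ => adjInd_nonneg G a b)
      _ ≤ _ := hU'
      _ ≤ 1 / (512 * 513) * d * (513 * B.card) := by gcongr
      _ = _ := by ring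
  calc ∑ v, nbrFrac G d B v ^ 2
      ≤ ∑ v, (nbrFrac G d B v / 512 + if 1 / 512 ≤ nbrFrac G d B v then nbrFrac G d B v else 0) := by
        refine Finset.sum_le_sum fun v _ => ?_
        have h0 := nbrFrac_nonneg G d B v
        have h1 := nbrFrac_le_one hG B v
        split_ifs with h
        · nlinarith
        · nlinarith
    _ ≤ _ := by
        rw [Finset.sum_add_distrib, ← Finset.sum_div, hsum, ← Finset.sum_filter]
        linarith
end

/-! ### Random regular graphs are mixing and sparse. -/

open Classical in
theorem card_filter_le_rect {n d : ℕ} (hd : 4 ≤ d) (hn : 4 * (d + 1) ≤ n)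
    (T B : Finset (Fin n)) :
    (((regularGraphs n d).filter fun G => (d : ℝ) * (T.card * B.card) / n + 8 * d ^ 2 +
      10 * n * √d ≤ edgeWeight (rectInd T B) G).card : ℝ) ≤
      (regularGraphs n d).card * Real.exp (-2 * n) := by
  have hd' : (4 : ℝ) ≤ d := by exact_mod_cast hd
  have hn' : 4 * ((d : ℝ) + 1) ≤ n := by exact_mod_cast hn
  have hn0 : (0 : ℝ) < n := by linarith
  set W : ℝ := T.card * B.card with hW
  have hT : (T.card : ℝ) ≤ n := by exact_mod_cast card_finset_fin_le T
  have hB : (B.card : ℝ) ≤ n := by exact_mod_cast card_finset_fin_le B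
  have hW0 : 0 ≤ W := by positivity
  have hWn : W / n ≤ n := by
    rw [div_le_iff₀ hn0]
    exact mul_le_mul hT hB (by positivity) hn0.le
  have hWn0 : 0 ≤ W / n := by positivity
  have hWe : W = W / n * n := by field_simp
  set α : ℝ := d * W / n + 8 * d ^ 2 with hα
  have hα' : α = d * (W / n) + 8 * d ^ 2 := by rw [hα, mul_div_assoc]
  have hs : 2 ≤ √(d : ℝ) := Real.le_sqrt_of_sq_le (by linarith)
  have hsq : √(d : ℝ) ^ 2 = d := Real.sq_sqrt (by linarith)
  have hpos : 0 < (n : ℝ) * d - 2 * d * (d + 1) := by nlinarith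
  -- With `θ = 1/(2√d)` the linear terms in `α` cancel. The quadratic term is at most `4αθ² ≤ 3n`
  -- because `α ≤ 3nd`, while `10n√d` contributes `-5n`, so the exponent is at most `-2n`. This
  -- beats the `4 ^ n` pairs of sets.
  have key := card_filter_le_edgeWeight (n := n) (d := d) (rectInd_nonneg T B) (rectInd_le_one T B)
    (α := α) hpos ?_ (θ := 1 / (2 * √d)) (by positivity) (α + 10 * n * √d)
  · refine key.trans (mul_le_mul_of_nonneg_left (Real.exp_le_exp.2 ?_) (Nat.cast_nonneg _))
    set θ : ℝ := 1 / (2 * √d) with hθ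
    have hθ0 : 0 ≤ θ := by positivity
    have h4 : 4 * θ ≤ 1 := by
      rw [hθ, mul_one_div, div_le_one (by positivity)]; linarith
    have hexp : Real.exp (4 * θ) - 1 ≤ 4 * θ + 16 * θ ^ 2 := by
      have := (abs_le.1 (Real.abs_exp_sub_one_sub_id_le (x := 4 * θ)
        (by rw [abs_of_nonneg (by positivity)]; exact h4))).2
      nlinarith
    have hα0 : 0 ≤ α := by
      rw [hα']
      exact add_nonneg (mul_nonneg (by linarith) hWn0) (by nlinarith)
    have hα3 : α ≤ 3 * n * d := by rw [hα']; nlinarith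
    have e1 : θ * √d = 1 / 2 := by rw [hθ]; field_simp
    have e2 : θ ^ 2 * d = 1 / 4 := by
      rw [← hsq, ← mul_pow, e1]; norm_num
    have h5 : α * (Real.exp (4 * θ) - 1) / 4 ≤ α * θ + 4 * (α * θ ^ 2) := by
      nlinarith [mul_le_mul_of_nonneg_left hexp hα0]
    have h6 : α * θ ^ 2 ≤ 3 * n * d * θ ^ 2 := by gcongr
    nlinarith
  · rw [sum_rectInd, ← hW, hα']
    have h1 : (n : ℝ) * d / 2 ≤ n * d - 2 * d * (d + 1) := by nlinarith
    have h2 : d * (W / n) * (2 * d * (d + 1)) ≤ d * n * (2 * d * (d + 1)) := by gcongr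
    have h3 : 8 * (d : ℝ) ^ 2 * (n * d / 2) ≤ 8 * d ^ 2 * (n * d - 2 * d * (d + 1)) := by gcongr
    have h4 : (d : ℝ) * n * (2 * d * (d + 1)) ≤ 8 * (d : ℝ) ^ 2 * (n * d / 2) := by
      have : (0 : ℝ) ≤ n * d ^ 2 := by positivity
      nlinarith
    have h5 : d * (W / n) * (n * d) = d ^ 2 * W := by
      conv_rhs => rw [hWe]
      ring
    have h6 : (d * (W / n) + 8 * (d : ℝ) ^ 2) * (n * d - 2 * d * (d + 1)) =
        d * (W / n) * (n * d) - d * (W / n) * (2 * d * (d + 1)) +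
          8 * d ^ 2 * (n * d - 2 * d * (d + 1)) := by ring
    rw [h6, h5]
    linarith

open Classical in
/-- Random regular graphs are mixing with high probability. -/
theorem card_not_isMixing_le {n d : ℕ} (hd : 4 ≤ d) (hn : 4 * (d + 1) ≤ n) :
    (((regularGraphs n d).filter fun G =>
        ¬ IsMixing G d (20 * ((d : ℝ) / n + 1 / √d))).card : ℝ) ≤
      (regularGraphs n d).card * (4 * Real.exp (-2)) ^ n := by
  have hd0 : (0 : ℝ) < d := by positivity
  have hn0 : (0 : ℝ) < n := by
    have : 0 < n := by omega
    positivity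
  have hsub : ((regularGraphs n d).filter fun G =>
      ¬ IsMixing G d (20 * ((d : ℝ) / n + 1 / √d))) ⊆
      (Finset.univ : Finset (Finset (Fin n) × Finset (Fin n))).biUnion fun p =>
        (regularGraphs n d).filter fun G => (d : ℝ) * (p.1.card * p.2.card) / n + 8 * d ^ 2 +
          10 * n * √d ≤ edgeWeight (rectInd p.1 p.2) G := by
    intro G hG
    rw [Finset.mem_filter] at hG
    obtain ⟨hGR, hG⟩ := hG
    simp only [IsMixing, not_forall, not_le] at hG
    obtain ⟨B, hB⟩ := hG
    obtain ⟨T, hT⟩ := sum_abs_nbrFrac_sub (by omega) (mem_regularGraphs.1 hGR) B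
    rw [hT, Fintype.card_fin] at hB
    simp only [Finset.mem_biUnion, Finset.mem_univ, true_and, Finset.mem_filter]
    refine ⟨(T, B), hGR, ?_⟩
    dsimp only
    set X := edgeWeight (rectInd T B) G
    have hs : √(d : ℝ) * √d = d := Real.mul_self_sqrt hd0.le
    have hs0 : 0 < √(d : ℝ) := Real.sqrt_pos.2 hd0
    have e1 : X = X / d * d := by field_simp
    have e2 : 20 * ((d : ℝ) / n + 1 / √d) * n = 20 * d + 20 * n / √d := by field_simp
    have e3 : (n : ℝ) / √d * d = n * √d := by
      rw [div_mul_eq_mul_div, div_eq_iff hs0.ne', mul_assoc, hs]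
    have e4 : (d : ℝ) * (T.card * B.card) / n = T.card * B.card / n * d := by ring
    rw [e1, e4]
    rw [e2] at hB
    have h3 := mul_lt_mul_of_pos_right hB hd0
    have e5 : 20 * (n : ℝ) / √d * d = 20 * (n * √d) := by rw [← e3]; ring
    nlinarith
  have hcard := (Finset.card_le_card hsub).trans Finset.card_biUnion_le
  have hcard' : (((regularGraphs n d).filter fun G =>
      ¬ IsMixing G d (20 * ((d : ℝ) / n + 1 / √d))).card : ℝ) ≤
      ∑ p : Finset (Fin n) × Finset (Fin n), (regularGraphs n d).card * Real.exp (-2 * n) :=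
    (Nat.cast_le.2 hcard).trans
      (by push_cast; exact Finset.sum_le_sum fun p _ => card_filter_le_rect hd hn p.1 p.2)
  refine hcard'.trans (le_of_eq ?_)
  rw [Finset.sum_const, Finset.card_univ, Fintype.card_prod, Fintype.card_finset,
    Fintype.card_fin, nsmul_eq_mul, mul_pow, ← Real.exp_nat_mul]
  push_cast
  rw [show (4 : ℝ) = 2 * 2 by norm_num, mul_pow, mul_comm (n : ℝ)]
  ring

theorem choose_le_exp_pow (n m : ℕ) (hm : 0 < m) :
    (n.choose m : ℝ) ≤ (Real.exp 1 * (n / m)) ^ m := by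
  have hm' : (0 : ℝ) < m := by positivity
  have h1 := Nat.choose_le_pow_div (α := ℝ) m n
  have h2 := Real.pow_div_factorial_le_exp (m : ℝ) hm'.le m
  have hf : (0 : ℝ) < m.factorial := by positivity
  rw [div_le_iff₀ hf] at h2
  rw [le_div_iff₀ hf] at h1
  rw [mul_pow, div_pow, ← Real.exp_nat_mul, mul_one, mul_div_assoc', le_div_iff₀ (by positivity)]
  calc (n.choose m : ℝ) * m ^ m ≤ n.choose m * (Real.exp m * m.factorial) := by gcongr
    _ = Real.exp m * (n.choose m * m.factorial) := by ring
    _ ≤ _ := by gcongr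

-- The exponent `θ` is chosen so that `exp (4θ) = n/|U|`, the optimal order for a Poisson tail far
-- above its mean. The bound on `|U|` gives `η * log (n/|U|) ≥ 4`, so half of the gain pays for the
-- exponential moment and the rest is at least `4|U| log (n/|U|)`.
open Classical in
theorem card_filter_le_square {n d : ℕ} {η : ℝ} (hη : 0 < η) (hη1 : η ≤ 1) (hd : 32 ≤ η * d)
    (hn : 4 * (d + 1) ≤ n) (U : Finset (Fin n)) (hU0 : 0 < U.card)
    (hU : (U.card : ℝ) ≤ Real.exp (-(4 / η)) * n) :
    (((regularGraphs n d).filter fun G =>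
      η * d * U.card ≤ edgeWeight (rectInd U U) G).card : ℝ) ≤
      (regularGraphs n d).card * Real.exp (-(4 * U.card * Real.log (n / U.card))) := by
  set m : ℝ := (U.card : ℝ) with hm
  have hm0 : 0 < m := by rw [hm]; positivity
  have hn' : 4 * ((d : ℝ) + 1) ≤ n := by exact_mod_cast hn
  have hd0 : (0 : ℝ) < d := by nlinarith
  have hn0 : (0 : ℝ) < n := by linarith
  have hx : Real.exp (4 / η) ≤ n / m := by
    rw [le_div_iff₀ hm0]
    calc Real.exp (4 / η) * m ≤ Real.exp (4 / η) * (Real.exp (-(4 / η)) * n) := by gcongr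
      _ = n := by rw [← mul_assoc, ← Real.exp_add]; simp
  set x : ℝ := n / m with hxdef
  have hx0 : 0 < x := by positivity
  have hlog : 4 / η ≤ Real.log x := (Real.le_log_iff_exp_le hx0).2 hx
  have hlog' : 4 ≤ η * Real.log x := by rwa [div_le_iff₀' hη] at hlog
  have hlog0 : 0 < Real.log x := lt_of_lt_of_le (by positivity) hlog
  have hd1 : (1 : ℝ) ≤ d := by nlinarith
  have hpos : 0 < (n : ℝ) * d - 2 * d * (d + 1) := by nlinarith
  have key := card_filter_le_edgeWeight (n := n) (d := d) (rectInd_nonneg U U) (rectInd_le_one U U)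
    (α := 2 * d * m ^ 2 / n) hpos ?_ (θ := Real.log x / 4) (by positivity) (η * d * m)
  · refine key.trans ?_
    gcongr
    rw [mul_div_cancel₀ _ (by norm_num : (4 : ℝ) ≠ 0), Real.exp_log hx0]
    have e1 : 2 * d * m ^ 2 / n * x = 2 * d * m := by rw [hxdef]; field_simp
    have h1 : 2 * d * m ^ 2 / n * (x - 1) / 4 ≤ d * m / 2 := by
      have : 0 ≤ 2 * d * m ^ 2 / n := by positivity
      nlinarith
    have h2 : d * m * 4 ≤ d * m * (η * Real.log x) := by gcongr
    have h3 : 32 * (m * Real.log x) ≤ η * d * (m * Real.log x) := by gcongr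
    nlinarith
  · rw [sum_rectInd, ← hm]
    have h1 : (n : ℝ) * d / 2 ≤ n * d - 2 * d * (d + 1) := by nlinarith
    calc (d : ℝ) ^ 2 * (m * m) = 2 * d * m ^ 2 / n * (n * d / 2) := by field_simp
      _ ≤ _ := by gcongr

open Classical in
/-- Random regular graphs are sparse with high probability. -/
theorem card_not_isSparse_le {n d : ℕ} {η : ℝ} (hη : 0 < η) (hη1 : η ≤ 1) (hd : 32 ≤ η * d)
    (hn : 4 * (d + 1) ≤ n) :
    (((regularGraphs n d).filter fun G =>
        ¬ IsSparse G d (Real.exp (-(4 / η))) η).card : ℝ) ≤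
      (regularGraphs n d).card * (4 / n) := by
  have hn0 : (0 : ℝ) < n := by
    have : 0 < n := by omega
    positivity
  set c := Real.exp (-(4 / η)) with hc
  set M := (Finset.Icc 1 n).filter fun m : ℕ => (m : ℝ) ≤ c * n with hM
  have hsub : ((regularGraphs n d).filter fun G => ¬ IsSparse G d c η) ⊆
      M.biUnion fun m => (Finset.powersetCard m Finset.univ).biUnion fun U =>
        (regularGraphs n d).filter fun G => η * d * U.card ≤ edgeWeight (rectInd U U) G := by
    intro G hG
    rw [Finset.mem_filter] at hG
    obtain ⟨hGR, hG⟩ := hG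
    simp only [IsSparse, not_forall, not_le, exists_prop, Fintype.card_fin] at hG
    obtain ⟨U, hU, hG⟩ := hG
    have hne : 0 < U.card := by
      rcases U.eq_empty_or_nonempty with h | h
      · simp [h] at hG
      · exact h.card_pos
    simp only [Finset.mem_biUnion, Finset.mem_filter, Finset.mem_powersetCard, hM, Finset.mem_Icc]
    exact ⟨U.card, ⟨⟨hne, card_finset_fin_le U⟩, hU⟩, U, ⟨Finset.subset_univ U, rfl⟩, hGR,
      by rw [edgeWeight_rectInd]; exact hG.le⟩
  have hcard : (((regularGraphs n d).filter fun G => ¬ IsSparse G d c η).card : ℝ) ≤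
      ∑ m ∈ M, ∑ U ∈ Finset.powersetCard m (Finset.univ : Finset (Fin n)),
        (((regularGraphs n d).filter fun G =>
          η * d * U.card ≤ edgeWeight (rectInd U U) G).card : ℝ) := by
    refine le_trans (Nat.cast_le.2 (Finset.card_le_card hsub)) ?_
    refine le_trans (Nat.cast_le.2 (Finset.card_biUnion_le
      |>.trans (Finset.sum_le_sum fun m _ => Finset.card_biUnion_le))) ?_
    push_cast
    exact le_rfl
  refine hcard.trans ?_
  have hterm : ∀ m ∈ M, ∑ U ∈ Finset.powersetCard m (Finset.univ : Finset (Fin n)),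
        (((regularGraphs n d).filter fun G =>
          η * d * U.card ≤ edgeWeight (rectInd U U) G).card : ℝ) ≤
      (regularGraphs n d).card * (4 / n ^ 2) := by
    intro m hm
    simp only [hM, Finset.mem_filter, Finset.mem_Icc] at hm
    obtain ⟨⟨hm1, hmn⟩, hmc⟩ := hm
    have hm0 : (0 : ℝ) < m := by exact_mod_cast hm1
    have hx : Real.exp (4 / η) ≤ n / m := by
      rw [le_div_iff₀ hm0]
      calc Real.exp (4 / η) * m ≤ Real.exp (4 / η) * (c * n) := by gcongr
        _ = n := by rw [hc, ← mul_assoc, ← Real.exp_add]; simp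
    set x : ℝ := n / m with hxdef
    have hx0 : 0 < x := by positivity
    have hlog : 4 / η ≤ Real.log x := (Real.le_log_iff_exp_le hx0).2 hx
    have h4 : 4 ≤ 4 / η := by rw [le_div_iff₀ hη]; linarith
    have hlog1 : 1 ≤ Real.log x := by linarith
    have hx2 : 2 ≤ x := by linarith [Real.add_one_le_exp (4 / η)]
    calc _ ≤ ∑ U ∈ Finset.powersetCard m (Finset.univ : Finset (Fin n)),
          (regularGraphs n d).card * Real.exp (-(4 * m * Real.log x)) := by
          refine Finset.sum_le_sum fun U hU => ?_
          have hUm : U.card = m := (Finset.mem_powersetCard.1 hU).2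
          have := card_filter_le_square hη hη1 hd hn U (by omega) (by rw [hUm]; exact hmc)
          rwa [hUm] at this ⊢
      _ = (regularGraphs n d).card * (n.choose m * Real.exp (-(4 * m * Real.log x))) := by
          rw [Finset.sum_const, Finset.card_powersetCard, Finset.card_univ, Fintype.card_fin,
            nsmul_eq_mul]
          ring
      -- As `log x ≥ 1`, the number of sets is at most `(e * x) ^ m ≤ x ^ (2m)`, which uses up half
      -- of the exponent `4m log x`.
      _ ≤ (regularGraphs n d).card * (4 / n ^ 2) := by
          gcongr
          calc (n.choose m : ℝ) * Real.exp (-(4 * m * Real.log x))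
              ≤ (Real.exp 1 * x) ^ m * Real.exp (-(4 * m * Real.log x)) := by
                gcongr
                exact choose_le_exp_pow n m hm1
            _ = Real.exp (m * (1 + Real.log x) - 4 * m * Real.log x) := by
                rw [sub_eq_add_neg, Real.exp_add, Real.exp_nat_mul, Real.exp_add,
                  Real.exp_log hx0]
            _ ≤ Real.exp (((2 * m : ℕ) : ℝ) * Real.log (x⁻¹)) := by
                rw [Real.log_inv]
                push_cast
                gcongr
                nlinarith
            _ = (m / n) ^ (2 * m) := by
                rw [Real.exp_nat_mul, Real.exp_log (by positivity), hxdef, inv_div]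
            -- Of the `m` squared factors, `m - 1` are bounded by `1/4` and one is kept; `m ≤ 2 ^ m`
            -- absorbs its numerator.
            _ ≤ 4 / n ^ 2 := by
                have hy : (m : ℝ) / n ≤ 1 / 2 := by
                  rw [← inv_div, ← hxdef, one_div]
                  exact inv_anti₀ (by norm_num) hx2
                have hp : (m : ℝ) ≤ 2 ^ m := by exact_mod_cast Nat.lt_two_pow_self.le
                obtain ⟨k, rfl⟩ : ∃ k, m = k + 1 := ⟨m - 1, by omega⟩
                rw [pow_mul, pow_succ]
                calc ((((k + 1 : ℕ) : ℝ) / n) ^ 2) ^ k * (((k + 1 : ℕ) : ℝ) / n) ^ 2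
                    ≤ ((1 / 2 : ℝ) ^ 2) ^ k * (((2 : ℝ) ^ (k + 1)) / n) ^ 2 := by gcongr
                  _ = 4 / (n : ℝ) ^ 2 * (((1 / 2) ^ 2) ^ k * (2 ^ k) ^ 2) := by
                      rw [pow_succ, div_pow, mul_pow]; ring
                  _ = 4 / (n : ℝ) ^ 2 := by
                      rw [← pow_mul, ← pow_mul, mul_comm k 2, ← mul_pow]; norm_num
  calc _ ≤ ∑ m ∈ M, (regularGraphs n d).card * (4 / (n : ℝ) ^ 2) := Finset.sum_le_sum hterm
    _ ≤ n * ((regularGraphs n d).card * (4 / (n : ℝ) ^ 2)) := by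
        rw [Finset.sum_const, nsmul_eq_mul]
        gcongr
        exact (Finset.card_filter_le _ _).trans (by simp)
    _ = _ := by field_simp

/-! ### Concentration for independent draws. -/

section
variable {V α : Type} [Fintype V] [DecidableEq V]

theorem sum_piFinset_sum (S : V → Finset α) (hS : ∀ v, (S v).Nonempty) (Z : V → α → ℝ) :
    ∑ c ∈ Fintype.piFinset S, ∑ v, Z v (c v) =
      (Fintype.piFinset S).card * ∑ v, (∑ p ∈ S v, Z v p) / (S v).card := by
  rw [Finset.sum_comm, Finset.mul_sum]
  refine Finset.sum_congr rfl fun v _ => ?_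
  -- A single coordinate is averaged by viewing it as a product whose other factors are all `1`.
  have h := Finset.prod_univ_sum S fun x p => if x = v then Z v p else 1
  have h1 : ∀ c : V → α, ∏ x, (if x = v then Z v (c x) else 1) = Z v (c v) := fun c => by simp
  simp only [h1] at h
  have h2 : ∀ x, (∑ p ∈ S x, if x = v then Z v p else 1) =
      (S x).card * (if x = v then (∑ p ∈ S v, Z v p) / (S v).card else 1) := by
    intro x
    have : ((S x).card : ℝ) ≠ 0 := by exact_mod_cast (hS x).card_pos.ne'
    split_ifs with hx
    · subst hx
      field_simp
    · simp
  rw [← h, Fintype.card_piFinset]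
  simp only [h2]
  rw [Finset.prod_mul_distrib]
  simp

/-- A Chernoff bound from `exp y ≤ 1 + y + y²` for `|y| ≤ 1`. The choice `θ = t/(2n)` minimises `nθ²
- θt`, and `t ≤ 2n` ensures `θ ≤ 1`. -/
theorem card_piFinset_tail_le (S : V → Finset α) (hS : ∀ v, (S v).Nonempty) (Z : V → α → ℝ)
    (h0 : ∀ v p, 0 ≤ Z v p) (h1 : ∀ v p, Z v p ≤ 1) {t : ℝ} (ht : 0 ≤ t)
    (htn : t ≤ 2 * Fintype.card V) :
    ∑ c ∈ Fintype.piFinset S, (open Classical in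
      if (∑ v, (∑ p ∈ S v, Z v p) / (S v).card) + t ≤ ∑ v, Z v (c v) then (1 : ℝ) else 0) ≤
      (Fintype.piFinset S).card * Real.exp (-(t ^ 2 / (4 * Fintype.card V))) := by
  classical
  -- For empty `V` the exponent is a division by zero, hence `0`, and the bound is trivial.
  rcases isEmpty_or_nonempty V with hV | hV
  · refine (Finset.sum_le_sum fun c _ => (?_ : _ ≤ (1 : ℝ))).trans ?_
    · split_ifs <;> norm_num
    · simp
  set n : ℝ := (Fintype.card V : ℝ) with hn
  have hn0 : 0 < n := by rw [hn]; exact_mod_cast Fintype.card_pos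
  set q : V → ℝ := fun v => (∑ p ∈ S v, Z v p) / (S v).card with hq
  have hcard : ∀ v, (0 : ℝ) < (S v).card := fun v => by exact_mod_cast (hS v).card_pos
  have hq0 : ∀ v, 0 ≤ q v := fun v =>
    div_nonneg (Finset.sum_nonneg fun p _ => h0 v p) (Nat.cast_nonneg _)
  have hq1 : ∀ v, q v ≤ 1 := fun v => by
    rw [hq]; dsimp only
    rw [div_le_one (hcard v)]
    exact (Finset.sum_le_sum fun p _ => h1 v p).trans (by simp)
  set θ : ℝ := t / (2 * n) with hθ
  have hθ0 : 0 ≤ θ := by positivity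
  have hθ1 : θ ≤ 1 := by rw [hθ, div_le_one (by positivity)]; exact htn
  have hfac : ∀ v, ∑ p ∈ S v, Real.exp (θ * (Z v p - q v)) ≤ (S v).card * Real.exp (θ ^ 2) := by
    intro v
    have hpt : ∀ p ∈ S v, Real.exp (θ * (Z v p - q v)) ≤ 1 + θ * (Z v p - q v) + θ ^ 2 := by
      intro p _
      have ha : |Z v p - q v| ≤ 1 := by
        rw [abs_le]; constructor <;> linarith [h0 v p, h1 v p, hq0 v, hq1 v]
      have hb : |θ * (Z v p - q v)| ≤ 1 := by
        rw [abs_mul, abs_of_nonneg hθ0]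
        exact mul_le_one₀ hθ1 (abs_nonneg _) ha
      have hc := (abs_le.1 (Real.abs_exp_sub_one_sub_id_le hb)).2
      have hd : (Z v p - q v) ^ 2 ≤ 1 := (sq_le_one_iff_abs_le_one _).2 ha
      have he : (θ * (Z v p - q v)) ^ 2 ≤ θ ^ 2 := by
        rw [mul_pow]; exact mul_le_of_le_one_right (sq_nonneg _) hd
      linarith
    refine (Finset.sum_le_sum hpt).trans ?_
    have hz : ∑ p ∈ S v, (Z v p - q v) = 0 := by
      have := (hcard v).ne'
      rw [Finset.sum_sub_distrib, Finset.sum_const, nsmul_eq_mul, hq]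
      dsimp only
      field_simp
      simp
    rw [Finset.sum_add_distrib, Finset.sum_add_distrib, ← Finset.mul_sum, hz]
    simp only [Finset.sum_const, nsmul_eq_mul, mul_one, mul_zero, add_zero]
    rw [← mul_one_add]
    gcongr
    linarith [Real.add_one_le_exp (θ ^ 2)]
  have hprod : ∑ c ∈ Fintype.piFinset S, Real.exp (θ * (∑ v, Z v (c v) - ∑ v, q v)) ≤
      (Fintype.piFinset S).card * Real.exp (n * θ ^ 2) := by
    calc _ = ∑ c ∈ Fintype.piFinset S, ∏ v, Real.exp (θ * (Z v (c v) - q v)) := by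
          refine Finset.sum_congr rfl fun c _ => ?_
          rw [← Real.exp_sum, ← Finset.mul_sum, Finset.sum_sub_distrib]
      _ = ∏ v, ∑ p ∈ S v, Real.exp (θ * (Z v p - q v)) :=
          (Finset.prod_univ_sum S fun v p => Real.exp (θ * (Z v p - q v))).symm
      _ ≤ ∏ v, ((S v).card * Real.exp (θ ^ 2)) :=
          Finset.prod_le_prod (fun v _ => Finset.sum_nonneg fun p _ => (Real.exp_pos _).le)
            fun v _ => hfac v
      _ = _ := by
          rw [Finset.prod_mul_distrib, Fintype.card_piFinset, Finset.prod_const, ← Real.exp_nat_mul,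
            Finset.card_univ]
          push_cast
          rfl
  calc _ ≤ ∑ c ∈ Fintype.piFinset S,
        Real.exp (θ * (∑ v, Z v (c v) - ∑ v, q v)) * Real.exp (-(θ * t)) := by
        refine Finset.sum_le_sum fun c _ => ?_
        rw [← Real.exp_add]
        split_ifs with h
        · rw [Real.one_le_exp_iff]
          nlinarith
        · exact (Real.exp_pos _).le
    _ ≤ (Fintype.piFinset S).card * Real.exp (n * θ ^ 2) * Real.exp (-(θ * t)) := by
        rw [← Finset.sum_mul]
        gcongr
    _ = _ := by
        rw [mul_assoc, ← Real.exp_add]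
        congr 2
        rw [hθ]
        field_simp
        ring
end

/-! ### The mean number of vertices with opinion `B` after one step. -/

open Classical in
/-- The indicator that `v` has opinion `B` after drawing the pair `p`. -/
noncomputable def lossInd {V : Type} (A : Finset V) (v : V) (p : V × V) : ℝ :=
  if (if (p.1 ∈ A ↔ p.2 ∈ A) then p.1 ∈ A else v ∈ A) then 0 else 1

theorem lossInd_nonneg {V : Type} (A : Finset V) (v : V) (p : V × V) : 0 ≤ lossInd A v p := by
  classical
  exact ite_nonneg le_rfl zero_le_one

theorem lossInd_le_one {V : Type} (A : Finset V) (v : V) (p : V × V) : lossInd A v p ≤ 1 := by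
  classical
  unfold lossInd
  by_cases h : (if (p.1 ∈ A ↔ p.2 ∈ A) then p.1 ∈ A else v ∈ A)
  · rw [if_pos h]; exact zero_le_one
  · rw [if_neg h]

-- A vertex of `A` is lost only if both samples are in `B`; a vertex of `B` is won only if both are
-- in `A`. Hence each indicator, or its complement, is a product over the two samples.
open Classical in
theorem sum_product_lossInd {V : Type} (N A : Finset V) (v : V) :
    ∑ p ∈ N ×ˢ N, lossInd A v p =
      if v ∈ A then (((N.filter fun w => ¬ w ∈ A).card : ℕ) : ℝ) ^ 2
      else (N.card : ℝ) ^ 2 - (((N.filter fun w => w ∈ A).card : ℕ) : ℝ) ^ 2 := by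
  have hmul : ∀ F : V → ℝ, ∑ p ∈ N ×ˢ N, F p.1 * F p.2 = (∑ w ∈ N, F w) ^ 2 := fun F => by
    rw [Finset.sum_product, sq, Finset.sum_mul_sum]
  split_ifs with hv
  · have : ∀ p : V × V, lossInd A v p =
        (fun w => if ¬ w ∈ A then (1 : ℝ) else 0) p.1 *
          (fun w => if ¬ w ∈ A then (1 : ℝ) else 0) p.2 := fun p => by
      unfold lossInd; dsimp only; split_ifs <;> simp_all
    rw [Finset.sum_congr rfl fun p _ => this p, hmul fun w => if ¬ w ∈ A then (1 : ℝ) else 0, Finset.sum_boole]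
  · have : ∀ p : V × V, lossInd A v p =
        1 - (fun w => if w ∈ A then (1 : ℝ) else 0) p.1 *
          (fun w => if w ∈ A then (1 : ℝ) else 0) p.2 := fun p => by
      unfold lossInd; dsimp only; split_ifs <;> simp_all
    rw [Finset.sum_congr rfl fun p _ => this p, Finset.sum_sub_distrib, hmul fun w => if w ∈ A then (1 : ℝ) else 0, Finset.sum_boole]
    simp [sq]

open Classical in
theorem sum_diag_lossInd {V : Type} (N A : Finset V) (v : V) :
    ∑ p ∈ N.diag, lossInd A v p = (((N.filter fun w => ¬ w ∈ A).card : ℕ) : ℝ) := by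
  rw [Finset.sum_diag]
  rw [Finset.card_filter]
  push_cast
  refine Finset.sum_congr rfl fun w _ => ?_
  rw [lossInd, ite_not]
  simp

open Classical in
theorem sum_offDiag_lossInd {V : Type} (N A : Finset V) (v : V) :
    ∑ p ∈ N.offDiag, lossInd A v p = ∑ p ∈ N ×ˢ N, lossInd A v p -
      (((N.filter fun w => ¬ w ∈ A).card : ℕ) : ℝ) := by
  rw [← sum_diag_lossInd N A v, ← Finset.diag_union_offDiag N,
    Finset.sum_union (Finset.disjoint_diag_offDiag N)]
  ring

section
variable {V : Type} [Fintype V]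

/-- The probability that `v` has opinion `B` after a step from the opinions `A`. -/
noncomputable def lossProb (s : Sampling) (G : SimpleGraph V) (A : Finset V) (v : V) : ℝ :=
  (∑ p ∈ samplePairs s G v, lossInd A v p) / (samplePairs s G v).card

open Classical in
theorem card_compl_updateOpinions (A : Finset V) (c : V → V × V) :
    (((updateOpinions A c)ᶜ.card : ℕ) : ℝ) = ∑ v, lossInd A v (c v) := by
  have h : (updateOpinions A c)ᶜ = Finset.univ.filter fun v =>
      ¬ (if ((c v).1 ∈ A ↔ (c v).2 ∈ A) then (c v).1 ∈ A else v ∈ A) := by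
    ext v
    simp [updateOpinions]
  rw [h, Finset.card_filter]
  push_cast
  refine Finset.sum_congr rfl fun v _ => ?_
  rw [lossInd, ite_not]

open Classical in
theorem card_filter_neighborFinset (G : SimpleGraph V) {d : ℕ} (hd : 2 ≤ d) (hG : IsDRegular G d)
    (A : Finset V) (v : V) :
    ((((G.neighborFinset v).filter fun w => w ∈ A).card : ℕ) : ℝ) = d * (1 - nbrFrac G d Aᶜ v) ∧
    ((((G.neighborFinset v).filter fun w => ¬ w ∈ A).card : ℕ) : ℝ) = d * nbrFrac G d Aᶜ v := by
  have hd' : (d : ℝ) ≠ 0 := by positivity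
  have h2 : ((((G.neighborFinset v).filter fun w => ¬ w ∈ A).card : ℕ) : ℝ) =
      d * nbrFrac G d Aᶜ v := by
    rw [nbrFrac, mul_div_cancel₀ _ hd']
    simp only [adjInd, Finset.sum_boole]
    congr 2
    ext w
    simp [and_comm]
  have h3 := Finset.card_filter_add_card_filter_not (s := G.neighborFinset v) (fun w => w ∈ A)
  have h4 : (G.neighborFinset v).card = d := by
    rw [SimpleGraph.card_neighborFinset_eq_degree]
    exact hG v
  rw [h4] at h3
  have h5 : ((((G.neighborFinset v).filter fun w => w ∈ A).card : ℕ) : ℝ) +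
    ((((G.neighborFinset v).filter fun w => ¬ w ∈ A).card : ℕ) : ℝ) = d := by exact_mod_cast h3
  exact ⟨by linarith, h2⟩

open Classical in
theorem card_neighborFinset_eq {G : SimpleGraph V} {d : ℕ} (hG : IsDRegular G d) (v : V) :
    (G.neighborFinset v).card = d := by
  rw [SimpleGraph.card_neighborFinset_eq_degree]
  exact hG v

open Classical in
theorem card_samplePairs (s : Sampling) {G : SimpleGraph V} {d : ℕ} (hG : IsDRegular G d) (v : V) :
    ((samplePairs s G v).card : ℝ) =
      match s with
      | .withReplacement => (d : ℝ) ^ 2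
      | .withoutReplacement => (d : ℝ) ^ 2 - d := by
  have h4 := card_neighborFinset_eq hG v
  unfold samplePairs
  cases s with
  | withReplacement =>
    dsimp only
    rw [Finset.card_product, h4]
    push_cast
    ring
  | withoutReplacement =>
    dsimp only
    rw [Finset.offDiag_card, h4, Nat.cast_sub (Nat.le_mul_self d)]
    push_cast
    ring

theorem samplePairs_nonempty (s : Sampling) {G : SimpleGraph V} {d : ℕ} (hd : 2 ≤ d)
    (hG : IsDRegular G d) (v : V) : (samplePairs s G v).Nonempty := by
  have hd' : (2 : ℝ) ≤ d := by exact_mod_cast hd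
  have h := card_samplePairs s hG v
  refine Finset.card_pos.1 (Nat.cast_pos.1 (?_ : (0 : ℝ) < _))
  rw [h]
  cases s <;> dsimp only <;> nlinarith

-- With replacement the bound holds without the last summand. Without replacement the repeated pairs
-- are removed: this only lowers the loss for `v ∈ A`, and the term with `2 / d` pays for the change
-- when `v ∉ A`.
open Classical in
theorem lossProb_le (s : Sampling) {G : SimpleGraph V} {d : ℕ} (hd : 2 ≤ d)
    (hG : IsDRegular G d) (A : Finset V) (v : V) :
    lossProb s G A v ≤ if v ∈ A then nbrFrac G d Aᶜ v ^ 2 else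
      2 * nbrFrac G d Aᶜ v - nbrFrac G d Aᶜ v ^ 2 + nbrFrac G d Aᶜ v * (2 / d) := by
  have hd' : (2 : ℝ) ≤ d := by exact_mod_cast hd
  have hd0 : (0 : ℝ) < d := by linarith
  obtain ⟨h1, h2⟩ := card_filter_neighborFinset G hd hG A v
  have h4 : ((G.neighborFinset v).card : ℝ) = d := by rw [card_neighborFinset_eq hG]
  have hcard := card_samplePairs s hG v
  have hprod := sum_product_lossInd (G.neighborFinset v) A v
  have hoff := sum_offDiag_lossInd (G.neighborFinset v) A v
  rw [h4, h1, h2] at hprod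
  rw [hprod, h2] at hoff
  unfold lossProb
  rw [hcard]
  have hb0 : 0 ≤ nbrFrac G d Aᶜ v := nbrFrac_nonneg _ _ _ _
  have hb1 : nbrFrac G d Aᶜ v ≤ 1 := nbrFrac_le_one hG _ _
  generalize nbrFrac G d Aᶜ v = b at *
  cases s with
  | withReplacement =>
    simp only [samplePairs]
    rw [hprod, div_le_iff₀ (by positivity)]
    split_ifs with hv
    · exact le_of_eq (by ring)
    · have : 0 ≤ b * (2 / d) * (d : ℝ) ^ 2 := by positivity
      nlinarith
  | withoutReplacement =>
    simp only [samplePairs]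
    rw [hoff, div_le_iff₀ (by nlinarith)]
    split_ifs with hv
    · have : 0 ≤ d * b * (1 - b) := by
        have := sub_nonneg.2 hb1
        positivity
      nlinarith
    · have e : b * (2 / d) * ((d : ℝ) ^ 2 - d) = b * (2 * d - 2) := by field_simp
      have h6 : 0 ≤ b * (1 - b) := mul_nonneg hb0 (sub_nonneg.2 hb1)
      rw [add_mul, e]
      nlinarith

theorem jointSamples_nonempty (s : Sampling) {G : SimpleGraph V} {d : ℕ} (hd : 2 ≤ d)
    (hG : IsDRegular G d) : (jointSamples s G).Nonempty := by
  classical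
  exact Fintype.piFinset_nonempty.2 fun v => samplePairs_nonempty s hd hG v

/-- The mean of `g` over the opinions after a step from the opinions `A`. -/
noncomputable def stepMean (s : Sampling) (G : SimpleGraph V) (A : Finset V)
    (g : Finset V → ℝ) : ℝ :=
  ∑ A', (votingStep s G A A').toReal * g A'

theorem stepMean_mono (s : Sampling) (G : SimpleGraph V) (A : Finset V) {g g' : Finset V → ℝ}
    (h : ∀ A', g A' ≤ g' A') : stepMean s G A g ≤ stepMean s G A g' :=
  Finset.sum_le_sum fun A' _ => mul_le_mul_of_nonneg_left (h A') ENNReal.toReal_nonneg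

theorem stepMean_add (s : Sampling) (G : SimpleGraph V) (A : Finset V) (g g' : Finset V → ℝ) :
    stepMean s G A (fun A' => g A' + g' A') = stepMean s G A g + stepMean s G A g' := by
  simp only [stepMean, mul_add, Finset.sum_add_distrib]

theorem stepMean_const_mul (s : Sampling) (G : SimpleGraph V) (A : Finset V) (a : ℝ)
    (g : Finset V → ℝ) : stepMean s G A (fun A' => a * g A') = a * stepMean s G A g := by
  simp only [stepMean, Finset.mul_sum]
  exact Finset.sum_congr rfl fun _ _ => by ring

theorem stepMean_const (s : Sampling) (G : SimpleGraph V) (A : Finset V) (a : ℝ) :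
    stepMean s G A (fun _ => a) = a := by
  classical
  have h := (votingStep s G A).tsum_coe
  rw [tsum_fintype] at h
  have h' := congrArg ENNReal.toReal h
  rw [ENNReal.toReal_sum fun a _ => (votingStep s G A).apply_ne_top a] at h'
  rw [stepMean, ← Finset.sum_mul, h']
  simp

theorem stepMean_eq (s : Sampling) {G : SimpleGraph V} {d : ℕ} (hd : 2 ≤ d)
    (hG : IsDRegular G d) (A : Finset V) (g : Finset V → ℝ) :
    stepMean s G A g =
      (∑ c ∈ jointSamples s G, g (updateOpinions A c)) / (jointSamples s G).card := by
  classical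
  have hne := jointSamples_nonempty s hd hG
  have hstep : ∀ A', (votingStep s G A A').toReal =
      ∑ c ∈ jointSamples s G, if updateOpinions A c = A' then ((jointSamples s G).card : ℝ)⁻¹
        else 0 := by
    intro A'
    rw [votingStep, dif_pos hne, PMF.map_apply, tsum_fintype]
    rw [ENNReal.toReal_sum]
    · rw [← Finset.sum_subset (Finset.subset_univ (jointSamples s G))]
      · refine Finset.sum_congr rfl fun c hc => ?_
        rw [PMF.uniformOfFinset_apply_of_mem hne hc]
        by_cases h : updateOpinions A c = A'
        · simp [h]
        · simp [h, Ne.symm h]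
      · intro c _ hc
        rw [PMF.uniformOfFinset_apply_of_notMem hne hc]
        simp
    · intro c _
      split_ifs
      · exact PMF.apply_ne_top _ _
      · simp
  simp only [stepMean, hstep, Finset.sum_mul]
  rw [Finset.sum_comm, Finset.sum_div]
  refine Finset.sum_congr rfl fun c _ => ?_
  simp only [ite_mul, zero_mul]
  rw [Finset.sum_ite_eq]
  simp [div_eq_inv_mul]

open Classical in
theorem stepMean_card_compl (s : Sampling) {G : SimpleGraph V} {d : ℕ} (hd : 2 ≤ d)
    (hG : IsDRegular G d) (A : Finset V) :
    stepMean s G A (fun A' => (A'ᶜ.card : ℝ)) = ∑ v, lossProb s G A v := by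
  have hne := (jointSamples_nonempty s hd hG).card_pos
  rw [stepMean_eq s hd hG]
  simp only [card_compl_updateOpinions]
  have h := sum_piFinset_sum (samplePairs s G) (samplePairs_nonempty s hd hG) (lossInd A)
  rw [div_eq_iff (by positivity), mul_comm]
  exact h

open Classical in
theorem stepMean_tail_le (s : Sampling) {G : SimpleGraph V} {d : ℕ} (hd : 2 ≤ d)
    (hG : IsDRegular G d) (A : Finset V) {t : ℝ} (ht : 0 ≤ t) (htn : t ≤ 2 * Fintype.card V) :
    stepMean s G A (fun A' => if (∑ v, lossProb s G A v) + t ≤ (A'ᶜ.card : ℝ) then 1 else 0) ≤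
      Real.exp (-(t ^ 2 / (4 * Fintype.card V))) := by
  have hne := (jointSamples_nonempty s hd hG).card_pos
  rw [stepMean_eq s hd hG]
  simp only [card_compl_updateOpinions]
  have h := card_piFinset_tail_le (samplePairs s G) (samplePairs_nonempty s hd hG) (lossInd A)
    (lossInd_nonneg A) (lossInd_le_one A) ht htn
  rw [div_le_iff₀ (by positivity), mul_comm (Real.exp _)]
  exact h

open Classical in
/-- When few vertices have opinion `B`, their number decreases by a constant factor. -/
theorem sum_lossProb_le_of_isSpreading (s : Sampling) {G : SimpleGraph V} {d : ℕ} (hd : 2 ≤ d)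
    (hG : IsDRegular G d) {θ : ℝ} (hS : IsSpreading G d θ) (A : Finset V)
    (hA : (Aᶜ.card : ℝ) ≤ θ * Fintype.card V) :
    ∑ v, lossProb s G A v ≤ (Aᶜ.card : ℝ) / 4 := by
  have hd' : (2 : ℝ) ≤ d := by exact_mod_cast hd
  have h := hS Aᶜ hA
  -- For `v` in `B` the loss is at most `3x - x²`, and `3x ≤ 24x² + 3/32` is `(16x - 1)² ≥ 0`. In
  -- total `25/256 + 3/32 = 49/256 < 1/4`.
  have hpt : ∀ v, lossProb s G A v ≤
      25 * nbrFrac G d Aᶜ v ^ 2 + if v ∈ Aᶜ then (3 / 32 : ℝ) else 0 := by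
    intro v
    refine (lossProb_le s hd hG A v).trans ?_
    have hb0 : 0 ≤ nbrFrac G d Aᶜ v := nbrFrac_nonneg _ _ _ _
    have h2 : 2 / (d : ℝ) ≤ 1 := by rw [div_le_one (by linarith)]; exact hd'
    have h3 := mul_le_mul_of_nonneg_left h2 hb0
    simp only [Finset.mem_compl]
    split_ifs with hv
    · simp; nlinarith
    · simp; nlinarith [sq_nonneg (16 * nbrFrac G d Aᶜ v - 1)]
  refine (Finset.sum_le_sum fun v _ => hpt v).trans ?_
  rw [Finset.sum_add_distrib, ← Finset.mul_sum, Finset.sum_ite_mem, Finset.univ_inter,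
    Finset.sum_const, nsmul_eq_mul]
  have : (0 : ℝ) ≤ Aᶜ.card := Nat.cast_nonneg _
  linarith

open Classical in
/-- On a mixing graph, the mean number of vertices with opinion `B` is close to its value on
the complete graph. -/
theorem sum_lossProb_le_of_isMixing (s : Sampling) {G : SimpleGraph V} {d : ℕ} (hd : 2 ≤ d)
    (hG : IsDRegular G d) {ε : ℝ} (hM : IsMixing G d ε) (A : Finset V) {b : ℝ}
    (hb : (Aᶜ.card : ℝ) = b * Fintype.card V) (hb0 : 0 ≤ b) (hb1 : b ≤ 1) :
    ∑ v, lossProb s G A v ≤ (3 * b ^ 2 - 2 * b ^ 3 + 2 * ε + 2 / d) * Fintype.card V := by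
  rcases isEmpty_or_nonempty V with hV | hV
  · simp
  have hn : (0 : ℝ) < Fintype.card V := by exact_mod_cast Fintype.card_pos
  have hd' : (2 : ℝ) ≤ d := by exact_mod_cast hd
  have h := hM Aᶜ
  rw [hb, mul_div_cancel_right₀ _ hn.ne'] at h
  -- Replacing `x` by `b` costs at most `2|x - b|`, since both `x²` and `2x - x²` are 2-Lipschitz on
  -- `[0, 1]`. Summing the main terms gives `b² + b(2b - 2b²) = 3b² - 2b³`.
  have hpt : ∀ v, lossProb s G A v ≤
      (b ^ 2 + if v ∈ Aᶜ then 2 * b - 2 * b ^ 2 else 0) + 2 * |nbrFrac G d Aᶜ v - b| + 2 / d := by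
    intro v
    refine (lossProb_le s hd hG A v).trans ?_
    have hx0 : 0 ≤ nbrFrac G d Aᶜ v := nbrFrac_nonneg _ _ _ _
    have hx1 : nbrFrac G d Aᶜ v ≤ 1 := nbrFrac_le_one hG _ _
    have h2 : 0 ≤ 2 / (d : ℝ) := by positivity
    have h3 := mul_le_mul_of_nonneg_right hx1 h2
    have h4 := le_abs_self (nbrFrac G d Aᶜ v - b)
    have h5 := neg_abs_le (nbrFrac G d Aᶜ v - b)
    have h6 := abs_nonneg (nbrFrac G d Aᶜ v - b)
    generalize nbrFrac G d Aᶜ v = x at *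
    generalize |x - b| = y at *
    have h7 : (x - b) * (x + b) ≤ y * 2 := by
      calc (x - b) * (x + b) ≤ y * (x + b) := by gcongr
        _ ≤ y * 2 := by gcongr; linarith
    have h8 : (x - b) * (2 - x - b) ≤ y * 2 := by
      calc (x - b) * (2 - x - b) ≤ y * (2 - x - b) := by
            apply mul_le_mul_of_nonneg_right h4; linarith
        _ ≤ y * 2 := by gcongr; linarith
    simp only [Finset.mem_compl]
    split_ifs with hv
    · simp; nlinarith
    · nlinarith
  refine (Finset.sum_le_sum fun v _ => hpt v).trans ?_
  rw [Finset.sum_add_distrib, Finset.sum_add_distrib, Finset.sum_add_distrib, ← Finset.mul_sum,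
    Finset.sum_ite_mem, Finset.univ_inter]
  simp only [Finset.sum_const, nsmul_eq_mul, Finset.card_univ]
  rw [hb]
  nlinarith
end

/-! ### The run against the adversary. -/

section
variable {V : Type} [Fintype V]

open Classical in
/-- The probability that, from the opinions `A` with the past `h`, more than `m` vertices have
opinion `B` now and after each of the next `r` steps. -/
noncomputable def failProb {f : ℕ} (s : Sampling) (G : SimpleGraph V) (σ : Adversary V f) (m : ℝ) :
    ℕ → Finset V → List (Finset V) → ℝ
  | 0, A, _ => if (Aᶜ.card : ℝ) ≤ m then 0 else 1
  | r + 1, A, h => if (Aᶜ.card : ℝ) ≤ m then 0 else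
      stepMean s G (σ.move h A) fun A' => failProb s G σ m r A' (A :: h)

theorem failProb_le_one {f : ℕ} (s : Sampling) (G : SimpleGraph V) (σ : Adversary V f) (m : ℝ) :
    ∀ r A h, failProb s G σ m r A h ≤ 1
  | 0, A, h => by
    classical
    unfold failProb; split_ifs <;> norm_num
  | r + 1, A, h => by
    classical
    unfold failProb
    split_ifs
    · norm_num
    · exact (stepMean_mono s G _ fun A' => failProb_le_one s G σ m r A' _).trans
        (stepMean_const s G _ 1).le

theorem failProb_nonneg {f : ℕ} (s : Sampling) (G : SimpleGraph V) (σ : Adversary V f) (m : ℝ) :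
    ∀ r A h, 0 ≤ failProb s G σ m r A h
  | 0, A, h => by
    classical
    unfold failProb; split_ifs <;> norm_num
  | r + 1, A, h => by
    classical
    unfold failProb
    split_ifs
    · norm_num
    · exact (stepMean_const s G _ 0).symm.le.trans
        (stepMean_mono s G _ fun A' => failProb_nonneg s G σ m r A' _)

/-- One step of the voting process with its history. -/
noncomputable def historyStep {f : ℕ} (s : Sampling) (G : SimpleGraph V) (σ : Adversary V f)
    (x : Finset V × List (Finset V)) : PMF (Finset V × List (Finset V)) :=
  (votingStep s G (σ.move x.2 x.1)).map fun A => (A, x.1 :: x.2)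

/-- The voting process from an arbitrary state. -/
noncomputable def votingRunFrom {f : ℕ} (s : Sampling) (G : SimpleGraph V) (σ : Adversary V f)
    (x : Finset V × List (Finset V)) : ℕ → PMF (Finset V × List (Finset V))
  | 0 => PMF.pure x
  | t + 1 => (historyStep s G σ x).bind fun y => votingRunFrom s G σ y t

/-- `votingRun` grows at its last step, whereas `failProb` recurses on the first; keeping the
history in the state makes the process Markov and the two views agree. -/
theorem votingRunFrom_succ {f : ℕ} (s : Sampling) (G : SimpleGraph V) (σ : Adversary V f) (t : ℕ) :
    ∀ x, votingRunFrom s G σ x (t + 1) = (votingRunFrom s G σ x t).bind (historyStep s G σ) := by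
  induction t with
  | zero => intro x; simp [votingRunFrom]
  | succ t ih =>
    intro x
    rw [votingRunFrom, votingRunFrom, PMF.bind_bind]
    simp only [ih]

theorem votingRun_eq_votingRunFrom {f : ℕ} (s : Sampling) (G : SimpleGraph V) (σ : Adversary V f)
    (A₀ : Finset V) (t : ℕ) : votingRun s G σ A₀ t = votingRunFrom s G σ (A₀, []) t := by
  induction t with
  | zero => rfl
  | succ t ih => rw [votingRunFrom_succ, ← ih]; rfl

-- Success is recorded in the history, so it is never lost; otherwise both sides obey the same
-- first-step recursion.
open Classical in
theorem votingRunFrom_compl_le {f : ℕ} (s : Sampling) (G : SimpleGraph V) (σ : Adversary V f)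
    (m : ℝ) (t : ℕ) : ∀ x, (votingRunFrom s G σ x t).toOuterMeasure (almostAllAdopted m)ᶜ ≤
      if x ∈ almostAllAdopted m then 0 else ENNReal.ofReal (failProb s G σ m t x.1 x.2) := by
  have hnot : ∀ x : Finset V × List (Finset V), x ∉ almostAllAdopted m → ¬ (x.1ᶜ.card : ℝ) ≤ m := by
    intro x hx h
    exact hx ⟨x.1, by simp, by convert h⟩
  induction t with
  | zero =>
    intro x
    rw [votingRunFrom, PMF.toOuterMeasure_pure_apply]
    by_cases hx : x ∈ almostAllAdopted m
    · simp [hx]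
    · simp [hx, failProb, hnot x hx]
  | succ t ih =>
    intro x
    rw [votingRunFrom, historyStep, PMF.bind_map, PMF.toOuterMeasure_bind_apply, tsum_fintype]
    by_cases hx : x ∈ almostAllAdopted m
    · rw [if_pos hx, nonpos_iff_eq_zero]
      refine Finset.sum_eq_zero fun A' _ => ?_
      have hx' : (A', x.1 :: x.2) ∈ almostAllAdopted m := by
        obtain ⟨A, hA, h⟩ := hx
        exact ⟨A, List.mem_cons_of_mem _ hA, h⟩
      have := ih (A', x.1 :: x.2)
      rw [if_pos hx', nonpos_iff_eq_zero] at this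
      rw [Function.comp_apply, this, mul_zero]
    · rw [if_neg hx, failProb, if_neg (hnot x hx), stepMean,
        ENNReal.ofReal_sum_of_nonneg fun A' _ =>
          mul_nonneg ENNReal.toReal_nonneg (failProb_nonneg _ _ _ _ _ _ _)]
      refine Finset.sum_le_sum fun A' _ => ?_
      rw [ENNReal.ofReal_mul ENNReal.toReal_nonneg, ENNReal.ofReal_toReal (PMF.apply_ne_top _ _)]
      gcongr
      refine (ih (A', x.1 :: x.2)).trans ?_
      split_ifs
      · exact zero_le
      · exact le_rfl

theorem votingRun_compl_le {f : ℕ} (s : Sampling) (G : SimpleGraph V) (σ : Adversary V f)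
    (m : ℝ) (A₀ : Finset V) (t : ℕ) :
    (votingRun s G σ A₀ t).toOuterMeasure (almostAllAdopted m)ᶜ ≤
      ENNReal.ofReal (failProb s G σ m t A₀ []) := by
  classical
  rw [votingRun_eq_votingRunFrom]
  refine (votingRunFrom_compl_le s G σ m t _).trans ?_
  split_ifs
  · exact zero_le
  · exact le_rfl

-- The redistribution leaves the size unchanged, so only the `f` corruptions count.
open Classical in
theorem AdversaryCan.card_compl_le {f : ℕ} {A A' : Finset V} (h : AdversaryCan f A A') :
    (A'ᶜ.card : ℝ) ≤ Aᶜ.card + f := by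
  obtain ⟨R, hR, hR'⟩ := h
  have h1 : R ⊆ A' ∪ symmDiff R A' := by
    intro v hv
    by_cases h : v ∈ A' <;> simp [Finset.mem_symmDiff, hv, h]
  have h2 := (Finset.card_le_card h1).trans (Finset.card_union_le _ _)
  have h3 := Finset.card_add_card_compl A
  have h4 := Finset.card_add_card_compl A'
  have hf' : (symmDiff R A').card ≤ f := by convert hR'
  have : A'ᶜ.card ≤ Aᶜ.card + f := by omega
  exact_mod_cast this

open Classical in
/-- Once few vertices have opinion `B`, it dies out quickly. -/
theorem failProb_le_of_few {f : ℕ} (s : Sampling) {G : SimpleGraph V} {d : ℕ} (hd : 2 ≤ d)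
    (hG : IsDRegular G d) (σ : Adversary V f) {m θ : ℝ} (hm : (f : ℝ) ≤ m) (hθ : 0 < θ)
    (hθ1 : θ ≤ 1) (hS : IsSpreading G d θ) (hf : (f : ℝ) ≤ θ * Fintype.card V / 2) (r : ℕ) :
    ∀ A h, (Aᶜ.card : ℝ) ≤ θ * Fintype.card V / 2 → failProb s G σ m r A h ≤
      (1 / 2) ^ r * Aᶜ.card + r * Real.exp (-(θ ^ 2 * Fintype.card V / 64)) := by
  set n : ℝ := (Fintype.card V : ℝ) with hn
  have hn0 : 0 ≤ n := Nat.cast_nonneg _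
  set q := Real.exp (-(θ ^ 2 * n / 64)) with hq
  have hq0 : 0 < q := Real.exp_pos _
  have hf0 : (0 : ℝ) ≤ f := Nat.cast_nonneg _
  induction r with
  | zero =>
    intro A h _
    unfold failProb
    split_ifs with hA
    · simp
    -- Failure means `|B| > m ≥ 0`, hence `|B| ≥ 1`, as in Markov's inequality.
    · have : (0 : ℝ) < Aᶜ.card := by linarith
      have : (1 : ℝ) ≤ Aᶜ.card := by exact_mod_cast this
      simpa using this
  | succ r ih =>
    intro A h hA
    unfold failProb
    split_ifs with hA'
    · positivity
    -- Here `|B| > m ≥ f`: the adversary at most doubles `|B|`, then spreading quarters the mean.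
    set A₁ := σ.move h A
    have h1 : (A₁ᶜ.card : ℝ) ≤ Aᶜ.card + f := (σ.allowed h A).card_compl_le
    have hM := sum_lossProb_le_of_isSpreading s hd hG hS A₁ (by linarith)
    set M := ∑ v, lossProb s G A₁ v
    have ht := stepMean_tail_le s hd hG A₁ (t := θ * n / 4) (by positivity) (by nlinarith)
    have hmean := stepMean_card_compl s hd hG A₁
    -- The mean `M` is at most `θn/4`, so leaving the regime `|B| ≤ θn/2` requires a deviation of at
    -- least `θn/4`.
    have hpt : ∀ A', failProb s G σ m r A' (A :: h) ≤ ((1 / 2) ^ r * A'ᶜ.card + r * q) +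
        if M + θ * n / 4 ≤ (A'ᶜ.card : ℝ) then 1 else 0 := by
      intro A'
      by_cases hc : (A'ᶜ.card : ℝ) ≤ θ * n / 2
      · refine (ih A' _ hc).trans (le_add_of_nonneg_right ?_)
        split_ifs <;> norm_num
      · rw [if_pos (by linarith)]
        refine (failProb_le_one s G σ m r A' _).trans (le_add_of_nonneg_left (by positivity))
    refine (stepMean_mono s G A₁ hpt).trans ?_
    rw [stepMean_add, stepMean_add, stepMean_const_mul, stepMean_const, hmean]
    have he : Real.exp (-((θ * n / 4) ^ 2 / (4 * n))) ≤ q := by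
      rcases hn0.eq_or_lt with h0 | h0
      · rw [hq, ← h0]; simp
      · rw [hq]
        apply le_of_eq
        congr 2
        field_simp
        norm_num
    have hp : (1 / 2 : ℝ) ^ r * M ≤ (1 / 2) ^ r * (Aᶜ.card / 2) := by
      gcongr
      linarith
    rw [pow_succ]
    push_cast
    linarith

theorem card_compl_eq_imbalance [Nonempty V] (A : Finset V) : (open Classical in
    (Aᶜ.card : ℝ) = (1 - imbalance A) / 2 * Fintype.card V) := by
  classical
  have h3 : (A.card : ℝ) + (Aᶜ.card : ℝ) = Fintype.card V := by
    exact_mod_cast Finset.card_add_card_compl A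
  have hn : (0 : ℝ) < Fintype.card V := by exact_mod_cast Fintype.card_pos
  unfold imbalance
  field_simp
  linarith

theorem imbalance_le_one (A : Finset V) : imbalance A ≤ 1 := by
  classical
  have h3 : (A.card : ℝ) + (Aᶜ.card : ℝ) = Fintype.card V := by
    exact_mod_cast Finset.card_add_card_compl A
  unfold imbalance
  refine div_le_one_of_le₀ ?_ (Nat.cast_nonneg _)
  have : (0 : ℝ) ≤ Aᶜ.card := Nat.cast_nonneg _
  linarith

/-- The recursion for the density of opinion `B` increases a moderate imbalance by a constant
factor, with room for errors. -/
theorem density_step {ν θ κ b : ℝ} (hθ0 : 0 < θ) (hθ1 : θ ≤ 1) (hκ : κ = θ / 32) (hν0 : 0 < ν)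
    (hν1 : ν ≤ 1 - θ) (hb0 : 0 ≤ b) (hb : b ≤ (1 - ν) / 2 + κ * ν) :
    3 * b ^ 2 - 2 * b ^ 3 + 4 * (κ * ν) + κ * ν ≤ (1 - (1 + κ) * ν) / 2 := by
  set y := (1 - ν) / 2 + κ * ν with hy
  have hκ0 : 0 < κ := by rw [hκ]; positivity
  have hκν : κ * ν ≤ ν / 32 := by rw [hκ]; nlinarith
  have hy1 : y ≤ 1 := by rw [hy]; linarith
  -- The cubic is increasing on `[0, 1]`, so the worst case is the largest density `y` that
  -- corruption can produce.
  have hmono : 3 * b ^ 2 - 2 * b ^ 3 ≤ 3 * y ^ 2 - 2 * y ^ 3 := by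
    have h1 : 0 ≤ (y - b) * (3 * (y + b) - 2 * (y ^ 2 + y * b + b ^ 2)) := by
      refine mul_nonneg (by linarith) ?_
      have hyb : 0 ≤ y := hb0.trans hb
      nlinarith [mul_nonneg hyb (sub_nonneg.2 hy1), mul_nonneg hb0 (sub_nonneg.2 (hb.trans hy1)),
        mul_nonneg hb0 (sub_nonneg.2 hy1)]
    nlinarith
  -- In terms of the imbalance `z` of `y`, the cubic map is `z ↦ z(3 - z²)/2`, and `z ≤ 1 - θ` gives
  -- `3 - z² ≥ 2 + θ`. The gain `θν/2 = 16κν` pays for all the losses.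
  set z := (1 - 2 * κ) * ν with hz
  have hyz : y = (1 - z) / 2 := by rw [hy, hz]; ring
  have hz0 : 0 ≤ z := by rw [hz]; refine mul_nonneg ?_ hν0.le; rw [hκ]; linarith
  have hzν : z ≤ 1 - θ := by rw [hz]; nlinarith
  have h2 : 3 * y ^ 2 - 2 * y ^ 3 = (1 - z * (3 - z ^ 2) / 2) / 2 := by rw [hyz]; ring
  have h3 : θ ≤ 1 - z ^ 2 := by nlinarith
  have h4 : z * (2 + θ) ≤ z * (3 - z ^ 2) := by gcongr; linarith
  have h5 : z * (2 + θ) = 2 * ν + θ * ν - 4 * (κ * ν) - 2 * (κ * ν) * θ := by rw [hz]; ring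
  have h6 : θ * ν = 32 * (κ * ν) := by rw [hκ]; ring
  have h7 : 0 < κ * ν := by positivity
  nlinarith

/-- This closes the induction on the failure bound `8/κ³/(ν²n)`: one step costs `4/κ²/(ν²n)`, and
the next bound has `ν` multiplied by `1 + κ`. -/
theorem geometric_margin {κ : ℝ} (hκ0 : 0 < κ) (hκ1 : κ ≤ 1) :
    8 / κ ^ 3 / (1 + κ) ^ 2 + 4 / κ ^ 2 ≤ 8 / κ ^ 3 := by
  have h1 : 1 / (1 + κ) ^ 2 ≤ 1 - κ / 2 := by
    rw [div_le_iff₀ (by positivity)]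
    nlinarith [mul_nonneg hκ0.le (sub_nonneg.2 hκ1), mul_nonneg (sq_nonneg κ) (sub_nonneg.2 hκ1)]
  have h2 : 8 / κ ^ 3 / (1 + κ) ^ 2 = 8 / κ ^ 3 * (1 / (1 + κ) ^ 2) := by ring
  have h3 : 4 / κ ^ 2 = 8 / κ ^ 3 * (κ / 2) := by field_simp; norm_num
  rw [h2, h3, ← mul_add]
  exact mul_le_of_le_one_right (by positivity) (by linarith)

set_option maxHeartbeats 1000000 in
open Classical in
/-- From a moderate imbalance the number of vertices with opinion `B` becomes small. -/
theorem failProb_le_of_imbalance [Nonempty V] {f : ℕ} (s : Sampling) {G : SimpleGraph V} {d : ℕ}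
    (hd : 2 ≤ d) (hG : IsDRegular G d) (σ : Adversary V f) {m θ κ ε ν₀ : ℝ} (hm : (f : ℝ) ≤ m)
    (hθ : 0 < θ) (hθ1 : θ ≤ 1) (hκ : κ = θ / 32) (hS : IsSpreading G d θ) (hM : IsMixing G d ε)
    (hν₀ : 0 < ν₀) (hν₁ : ν₀ ≤ 1) (hε : ε ≤ κ * ν₀) (hdκ : 1 / (d : ℝ) ≤ κ * ν₀)
    (hf : (f : ℝ) ≤ κ * ν₀ * Fintype.card V) (T₂ T k : ℕ) :
    ∀ A h, ν₀ ≤ imbalance A → 1 ≤ imbalance A * (1 + κ) ^ k → k + T₂ ≤ T →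
      failProb s G σ m (k + T₂) A h ≤ 8 / κ ^ 3 / (imbalance A ^ 2 * Fintype.card V) +
        ((1 / 2) ^ T₂ * Fintype.card V + T * Real.exp (-(θ ^ 2 * Fintype.card V / 64))) := by
  set n : ℝ := (Fintype.card V : ℝ) with hn
  have hn0 : 0 < n := by rw [hn]; exact_mod_cast Fintype.card_pos
  have hκ0 : 0 < κ := by rw [hκ]; positivity
  have hκ1 : κ ≤ 1 := by rw [hκ]; linarith
  have hf' : (f : ℝ) ≤ θ * n / 2 := by
    refine hf.trans ?_
    have h1 : κ * ν₀ ≤ κ * 1 := by gcongr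
    have h2 : κ * ν₀ ≤ θ / 2 := by rw [hκ] at h1 ⊢; linarith
    nlinarith
  set E := (1 / 2) ^ T₂ * n + T * Real.exp (-(θ ^ 2 * n / 64)) with hE
  have hfew : ∀ r A h, T₂ ≤ r → r ≤ T → (Aᶜ.card : ℝ) ≤ θ * n / 2 →
      failProb s G σ m r A h ≤ E := by
    intro r A h hr hrT hA
    refine (failProb_le_of_few s hd hG σ hm hθ hθ1 hS hf' r A h hA).trans ?_
    have h1 : (1 / 2 : ℝ) ^ r ≤ (1 / 2) ^ T₂ :=
      pow_le_pow_of_le_one (by norm_num) (by norm_num) hr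
    have h2 : (Aᶜ.card : ℝ) ≤ n := by rw [hn]; exact_mod_cast Finset.card_le_univ _
    have h3 : (r : ℝ) ≤ T := by exact_mod_cast hrT
    rw [hE]
    gcongr
  -- `k` bounds the number of growth steps before the imbalance would reach `1`; `T₂` steps are
  -- reserved for the regime of few `B`, which may be entered earlier; `T` only bounds the number of
  -- error terms there.
  induction k with
  | zero =>
    intro A h hA h1 hT
    have h2 : (Aᶜ.card : ℝ) ≤ θ * n / 2 := by
      rw [card_compl_eq_imbalance, ← hn]
      have : 1 ≤ imbalance A := by simpa using h1
      nlinarith [mul_pos hθ hn0]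
    refine (hfew _ A h (by omega) hT h2).trans (le_add_of_nonneg_left ?_)
    positivity
  | succ k ih =>
    intro A h hA h1 hT
    set ν := imbalance A with hν
    have hνpos : 0 < ν := hν₀.trans_le hA
    by_cases hc : (Aᶜ.card : ℝ) ≤ θ * n / 2
    · refine (hfew _ A h (by omega) hT hc).trans (le_add_of_nonneg_left ?_)
      positivity
    have hcard : (Aᶜ.card : ℝ) = (1 - ν) / 2 * n := card_compl_eq_imbalance A
    have hν1 : ν ≤ 1 - θ := by
      rw [hcard] at hc
      by_contra hcon
      exact hc (by nlinarith)
    rw [show k + 1 + T₂ = (k + T₂) + 1 by ring]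
    have hEpos : 0 ≤ E := by positivity
    unfold failProb
    split_ifs with hA'
    · positivity
    set A₁ := σ.move h A
    have hA₁ : (A₁ᶜ.card : ℝ) ≤ Aᶜ.card + f := (σ.allowed h A).card_compl_le
    set b : ℝ := A₁ᶜ.card / n with hb
    have hbn : (A₁ᶜ.card : ℝ) = b * n := by rw [hb]; field_simp
    have hb0 : 0 ≤ b := div_nonneg (Nat.cast_nonneg _) hn0.le
    have hκν : κ * ν₀ ≤ κ * ν := by gcongr
    have hb1 : b ≤ (1 - ν) / 2 + κ * ν := by
      rw [hb, div_le_iff₀ hn0]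
      nlinarith
    have hb2 : b ≤ 1 := by
      rw [hb, div_le_one hn0, hn]; exact_mod_cast Finset.card_le_univ _
    have hMM := sum_lossProb_le_of_isMixing s hd hG hM A₁ hbn hb0 hb2
    set M := ∑ v, lossProb s G A₁ v
    have hstep := density_step hθ hθ1 hκ hνpos hν1 hb0 hb1
    have hκν1 : κ * ν ≤ 1 := mul_le_one₀ hκ1 hνpos.le (by linarith)
    have ht := stepMean_tail_le s hd hG A₁ (t := κ * ν * n) (by positivity) (by nlinarith)
    have hMt : M + κ * ν * n ≤ (1 - (1 + κ) * ν) / 2 * n := by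
      have h2d : 2 / (d : ℝ) = 2 * (1 / d) := by ring
      have : (3 * b ^ 2 - 2 * b ^ 3 + 2 * ε + 2 / d) * n ≤
          (3 * b ^ 2 - 2 * b ^ 3 + 4 * (κ * ν)) * n := by
        gcongr ?_ * n
        rw [h2d]
        linarith
      have h2 := mul_le_mul_of_nonneg_right hstep hn0.le
      nlinarith
    set Q : ℝ := 8 / κ ^ 3 / ((1 + κ) ^ 2 * (ν ^ 2 * n)) with hQ
    have hQ0 : 0 ≤ Q := by positivity
    have hpt : ∀ A', failProb s G σ m (k + T₂) A' (A :: h) ≤ (Q + E) +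
        if M + κ * ν * n ≤ (A'ᶜ.card : ℝ) then 1 else 0 := by
      intro A'
      split_ifs with hc'
      · exact (failProb_le_one s G σ m _ A' _).trans (le_add_of_nonneg_left (by positivity))
      · have hc2 : (1 + κ) * ν ≤ imbalance A' := by
          rw [card_compl_eq_imbalance, ← hn] at hc'
          by_contra hcon
          exact hc' (by nlinarith)
        have hge : ν ≤ (1 + κ) * ν := le_mul_of_one_le_left hνpos.le (by linarith)
        refine (ih A' _ (by linarith) ?_ (by omega)).trans ?_
        · refine h1.trans ?_
          calc ν * (1 + κ) ^ (k + 1) = ((1 + κ) * ν) * (1 + κ) ^ k := by ring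
            _ ≤ _ := by gcongr
        · rw [add_zero, hQ, ← mul_assoc, ← mul_pow]
          gcongr
    refine (stepMean_mono s G A₁ hpt).trans ?_
    rw [stepMean_add, stepMean_const]
    -- Weakening `exp (-y)` to `1/y` makes the error of a step proportional to `1/ν²`, which sums
    -- geometrically.
    have hexp : Real.exp (-((κ * ν * n) ^ 2 / (4 * n))) ≤ 4 / κ ^ 2 / (ν ^ 2 * n) := by
      have hy : 0 < κ ^ 2 * ν ^ 2 * n / 4 := by positivity
      have e1 : (κ * ν * n) ^ 2 / (4 * n) = κ ^ 2 * ν ^ 2 * n / 4 := by field_simp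
      have e2 : 4 / κ ^ 2 / (ν ^ 2 * n) = (κ ^ 2 * ν ^ 2 * n / 4)⁻¹ := by field_simp
      rw [e1, e2, Real.exp_neg]
      exact inv_anti₀ hy (by linarith [Real.add_one_le_exp (κ ^ 2 * ν ^ 2 * n / 4)])
    have hfin : Q + 4 / κ ^ 2 / (ν ^ 2 * n) ≤ 8 / κ ^ 3 / (ν ^ 2 * n) := by
      have e1 : Q = 8 / κ ^ 3 / (1 + κ) ^ 2 / (ν ^ 2 * n) := by rw [hQ]; field_simp
      rw [e1, ← add_div]
      exact div_le_div_of_nonneg_right (geometric_margin hκ0 hκ1) (by positivity)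
    linarith
end

/-! ### Probability bounds and logarithmic time. -/

theorem PMF.toOuterMeasure_univ {α : Type*} (p : PMF α) : p.toOuterMeasure Set.univ = 1 :=
  (PMF.toOuterMeasure_apply_eq_one_iff _ _).2 (Set.subset_univ _)

theorem PMF.toOuterMeasure_le_one {α : Type*} (p : PMF α) (S : Set α) : p.toOuterMeasure S ≤ 1 :=
  p.toOuterMeasure_univ ▸ MeasureTheory.measure_mono (Set.subset_univ S)

theorem PMF.one_sub_le_toOuterMeasure {α : Type*} (p : PMF α) {S : Set α} {e : ENNReal}
    (h : p.toOuterMeasure Sᶜ ≤ e) : 1 - e ≤ p.toOuterMeasure S := by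
  rw [tsub_le_iff_left]
  calc (1 : ENNReal) = p.toOuterMeasure (Sᶜ ∪ S) := by
        rw [Set.compl_union_self, p.toOuterMeasure_univ]
    _ ≤ _ := (MeasureTheory.measure_union_le _ _).trans (by gcongr)

theorem PMF.tendsto_toOuterMeasure_one {α : ℕ → Type*} (p : ∀ k, PMF (α k)) (S : ∀ k, Set (α k))
    {e : ℕ → ℝ} (he : Tendsto e atTop (𝓝 0))
    (h : ∀ᶠ k in atTop, (p k).toOuterMeasure (S k)ᶜ ≤ ENNReal.ofReal (e k)) :
    Tendsto (fun k => (p k).toOuterMeasure (S k)) atTop (𝓝 1) := by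
  have h1 : Tendsto (fun k => 1 - ENNReal.ofReal (e k)) atTop (𝓝 1) := by
    have := ENNReal.Tendsto.sub (tendsto_const_nhds (x := (1 : ENNReal)) (f := atTop))
      ((ENNReal.continuous_ofReal.tendsto 0).comp he) (Or.inl ENNReal.one_ne_top)
    simpa using this
  exact tendsto_of_tendsto_of_tendsto_of_le_of_le' h1 tendsto_const_nhds
    (h.mono fun k hk => (p k).one_sub_le_toOuterMeasure hk)
    (Eventually.of_forall fun k => (p k).toOuterMeasure_le_one _)

/-- Conditioning on the random graph: bad graphs contribute at most their proportion, the others at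
most `e`. -/
theorem PMF.uniformOfFinset_bind_le {α β : Type} [Fintype α] (R bad : Finset α) (hR : R.Nonempty)
    (f : α → PMF β) (S : Set β) {e δ : ℝ} (he : 0 ≤ e) (hδ : (bad.card : ℝ) ≤ R.card * δ)
    (h : ∀ a ∈ R, a ∉ bad → (f a).toOuterMeasure S ≤ ENNReal.ofReal e) :
    ((PMF.uniformOfFinset R hR).bind f).toOuterMeasure S ≤ ENNReal.ofReal (e + δ) := by
  classical
  have hR0 : (0 : ℝ) < R.card := by exact_mod_cast hR.card_pos
  have hδ0 : 0 ≤ δ := by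
    by_contra hcon
    have h1 : (0 : ℝ) ≤ bad.card := Nat.cast_nonneg _
    nlinarith
  rw [PMF.toOuterMeasure_bind_apply, tsum_fintype]
  calc ∑ a, PMF.uniformOfFinset R hR a * (f a).toOuterMeasure S
      ≤ ∑ a, (PMF.uniformOfFinset R hR a * ENNReal.ofReal e +
          if a ∈ bad then (R.card : ENNReal)⁻¹ else 0) := by
        refine Finset.sum_le_sum fun a _ => ?_
        by_cases ha : a ∈ R
        · rw [PMF.uniformOfFinset_apply_of_mem hR ha]
          split_ifs with hb
          · refine le_add_left ?_
            exact mul_le_of_le_one_right' ((f a).toOuterMeasure_le_one S)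
          · rw [add_zero]
            gcongr
            exact h a ha hb
        · rw [PMF.uniformOfFinset_apply_of_notMem hR ha, zero_mul]
          exact zero_le
    _ = ENNReal.ofReal e + bad.card * (R.card : ENNReal)⁻¹ := by
        rw [Finset.sum_add_distrib, ← Finset.sum_mul, ← tsum_fintype (L := .unconditional _),
          PMF.tsum_coe, one_mul,
          Finset.sum_ite_mem, Finset.univ_inter, Finset.sum_const, nsmul_eq_mul]
    _ ≤ ENNReal.ofReal e + ENNReal.ofReal δ := by
        gcongr
        rw [← div_eq_mul_inv]
        refine ENNReal.div_le_of_le_mul ?_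
        rw [← ENNReal.ofReal_natCast, ← ENNReal.ofReal_natCast, ← ENNReal.ofReal_mul hδ0]
        exact ENNReal.ofReal_le_ofReal (by linarith)
    _ = _ := (ENNReal.ofReal_add he hδ0).symm

/-- The factor of `log n` in the duration of the voting. -/
noncomputable def timeFactor (κ : ℝ) : ℝ := 2 / Real.log 2 + 1 / Real.log (1 + κ) + 1

theorem one_le_timeFactor {κ : ℝ} (hκ : 0 < κ) : 1 ≤ timeFactor κ := by
  have h1 : 0 < Real.log 2 := Real.log_pos (by norm_num)
  have h2 : 0 < Real.log (1 + κ) := Real.log_pos (by linarith)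
  unfold timeFactor
  have : 0 < 2 / Real.log 2 + 1 / Real.log (1 + κ) := by positivity
  linarith

/-- The bound for the probability that voting fails on `n` vertices from the imbalance `ν`. -/
noncomputable def failBound (θ n ν : ℝ) : ℝ :=
  8 / (θ / 32) ^ 3 / (ν ^ 2 * n) +
    (1 / n + timeFactor (θ / 32) * Real.log n * Real.exp (-(θ ^ 2 * n / 64)))

/-- Voting on a mixing and spreading graph succeeds in logarithmic time. -/
theorem failProb_le_failBound {V : Type} [Fintype V] {f : ℕ} (s : Sampling) {G : SimpleGraph V}
    {d : ℕ} (hd : 2 ≤ d) (hG : IsDRegular G d) (σ : Adversary V f) {m θ ε : ℝ} (hm : (f : ℝ) ≤ m)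
    (hθ : 0 < θ) (hθ1 : θ ≤ 1) (hS : IsSpreading G d θ) (hM : IsMixing G d ε) {A₀ : Finset V}
    (hn : 3 ≤ Real.log (Fintype.card V)) (hν : 1 ≤ imbalance A₀ * √(Fintype.card V))
    (hε : ε ≤ θ / 32 * imbalance A₀) (hdκ : 1 / (d : ℝ) ≤ θ / 32 * imbalance A₀)
    (hf : (f : ℝ) ≤ θ / 32 * imbalance A₀ * Fintype.card V) :
    failProb s G σ m ⌊timeFactor (θ / 32) * Real.log (Fintype.card V)⌋₊ A₀ [] ≤
      failBound θ (Fintype.card V) (imbalance A₀) := by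
  set n : ℝ := (Fintype.card V : ℝ) with hndef
  set κ := θ / 32 with hκ
  have hκ0 : 0 < κ := by positivity
  have hnpos : 0 < n := by
    by_contra hcon
    have : n = 0 := le_antisymm (not_lt.1 hcon) (Nat.cast_nonneg _)
    rw [this, Real.log_zero] at hn
    linarith
  have : Nonempty V := by
    rw [← Fintype.card_pos_iff]
    exact (Nat.cast_pos (α := ℝ)).1 hnpos
  have hn1 : 1 ≤ n := by
    have : 0 < Fintype.card V := Fintype.card_pos
    rw [hndef]
    exact_mod_cast this
  have hs : √n ≤ n := Real.sqrt_le_iff.2 ⟨hnpos.le, by nlinarith⟩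
  have hs0 : 0 < √n := Real.sqrt_pos.2 hnpos
  have hνpos : 0 < imbalance A₀ := by
    by_contra hcon
    nlinarith
  have hlog2 : 0 < Real.log 2 := Real.log_pos (by norm_num)
  have hlogκ : 0 < Real.log (1 + κ) := Real.log_pos (by linarith)
  set T := ⌊timeFactor κ * Real.log n⌋₊ with hT
  -- In `T₂` halvings `n` drops below `1/n`. The summand `1 / log (1 + κ)` of `timeFactor` leaves
  -- enough steps for `(1 + κ) ^ k ≥ n ≥ √n`, and the summand `1`, worth `log n ≥ 3`, absorbs the
  -- floor and the ceiling.
  set T₂ := ⌈2 / Real.log 2 * Real.log n⌉₊ with hT₂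
  have hT1 : timeFactor κ * Real.log n - 1 < T := by
    rw [hT]; linarith [Nat.lt_floor_add_one (timeFactor κ * Real.log n)]
  have hT3 : (T : ℝ) ≤ timeFactor κ * Real.log n :=
    Nat.floor_le (mul_nonneg (by linarith [one_le_timeFactor hκ0]) (by linarith))
  have hT21 : (T₂ : ℝ) < 2 / Real.log 2 * Real.log n + 1 :=
    Nat.ceil_lt_add_one (by positivity)
  have hT22 : 2 / Real.log 2 * Real.log n ≤ T₂ := Nat.le_ceil _
  have hexpand : timeFactor κ * Real.log n = 2 / Real.log 2 * Real.log n +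
      1 / Real.log (1 + κ) * Real.log n + Real.log n := by unfold timeFactor; ring
  have hpos : 0 < 1 / Real.log (1 + κ) * Real.log n := by positivity
  have hle : T₂ ≤ T := by
    have : (T₂ : ℝ) ≤ T := by linarith
    exact_mod_cast this
  set k := T - T₂ with hk
  have hkT : k + T₂ = T := Nat.sub_add_cancel hle
  have hk' : (k : ℝ) = T - T₂ := by rw [hk, Nat.cast_sub hle]
  have hkge : 1 / Real.log (1 + κ) * Real.log n ≤ k := by rw [hk']; linarith
  have hpow : n ≤ (1 + κ) ^ k := by
    have h1 : Real.log n ≤ k * Real.log (1 + κ) := by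
      rw [one_div_mul_eq_div, div_le_iff₀ hlogκ] at hkge
      exact hkge
    have h2 := Real.exp_le_exp.2 h1
    rwa [Real.exp_log hnpos, Real.exp_nat_mul, Real.exp_log (by linarith)] at h2
  have hgrow : 1 ≤ imbalance A₀ * (1 + κ) ^ k :=
    hν.trans (mul_le_mul_of_nonneg_left (hs.trans hpow) hνpos.le)
  have hhalf : (1 / 2 : ℝ) ^ T₂ * n ≤ 1 / n := by
    have h1 : 2 * Real.log n ≤ T₂ * Real.log 2 := by
      rw [div_mul_eq_mul_div, div_le_iff₀ hlog2] at hT22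
      exact hT22
    have h2 : n ^ 2 ≤ 2 ^ T₂ := by
      have h2 := Real.exp_le_exp.2 h1
      rw [Real.exp_nat_mul, Real.exp_log (by norm_num), two_mul, Real.exp_add,
        Real.exp_log hnpos] at h2
      linarith
    rw [one_div_pow, one_div_mul_eq_div, div_le_div_iff₀ (by positivity) hnpos]
    nlinarith
  have key := failProb_le_of_imbalance s hd hG σ hm hθ hθ1 hκ hS hM hνpos (imbalance_le_one A₀)
    hε hdκ hf T₂ T k A₀ [] le_rfl hgrow hkT.le
  rw [hkT, ← hndef] at key
  refine key.trans ?_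
  unfold failBound
  rw [← hκ]
  gcongr

/-! ### Spectral bounds for expanders. -/

section
variable {V : Type} [Fintype V]

theorem transitionMatrix_mulVec (G : SimpleGraph V) (d : ℕ) (x : V → ℝ) (v : V) :
    (transitionMatrix G d).mulVec x v = (∑ w, adjInd G v w * x w) / d := by
  classical
  rw [transitionMatrix, Matrix.smul_mulVec, Pi.smul_apply, smul_eq_mul, one_div_mul_eq_div]
  simp only [Matrix.mulVec, dotProduct, SimpleGraph.adjMatrix_apply, adjInd]

theorem transitionMatrix_mulVec_one {G : SimpleGraph V} {d : ℕ} (hd : 0 < d)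
    (hG : IsDRegular G d) (v : V) : (transitionMatrix G d).mulVec (fun _ => 1) v = 1 := by
  have : (d : ℝ) ≠ 0 := by positivity
  rw [transitionMatrix_mulVec]
  simp only [mul_one]
  rw [(isDRegular_iff G d).1 hG, div_self this]

theorem transitionMatrix_mulVec_comm (G : SimpleGraph V) (d : ℕ) (x y : V → ℝ) :
    ∑ v, y v * (transitionMatrix G d).mulVec x v = ∑ v, (transitionMatrix G d).mulVec y v * x v := by
  simp only [transitionMatrix_mulVec, ← mul_div_assoc, div_mul_eq_mul_div, ← Finset.sum_div,
    Finset.mul_sum, Finset.sum_mul]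
  rw [Finset.sum_comm]
  congr 1
  refine Finset.sum_congr rfl fun v _ => Finset.sum_congr rfl fun w _ => ?_
  rw [adjInd_comm]
  ring

/-- The second eigenvalue controls the transition matrix on the vectors of mean zero. -/
theorem sum_sq_transitionMatrix_mulVec_le {G : SimpleGraph V} {d : ℕ} (hd : 0 < d)
    (hG : IsDRegular G d) (hV : 2 ≤ Fintype.card V) (hl : secondEigenvalue G d < 1) {x : V → ℝ}
    (hx : ∑ v, x v = 0) :
    ∑ v, (transitionMatrix G d).mulVec x v ^ 2 ≤ secondEigenvalue G d ^ 2 * ∑ v, x v ^ 2 := by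
  classical
  set hH := transitionMatrix_isHermitian G d with hHdef
  set l := secondEigenvalue G d with hldef
  have hl' : l = max (hH.eigenvalues₀ ⟨1, by omega⟩)
      |hH.eigenvalues₀ ⟨Fintype.card V - 1, by omega⟩| := by
    rw [hldef, secondEigenvalue, dif_pos hV]
  -- The eigenvalues are sorted, so all but the one of index `0` lie between the second and the
  -- last.
  have hsmall : ∀ i : Fin (Fintype.card V), i.1 ≠ 0 → |hH.eigenvalues₀ i| ≤ l := by
    intro i hi
    have h1 : hH.eigenvalues₀ i ≤ hH.eigenvalues₀ ⟨1, by omega⟩ :=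
      hH.eigenvalues₀_antitone (Fin.mk_le_of_le_val (by omega))
    have h2 : hH.eigenvalues₀ ⟨Fintype.card V - 1, by omega⟩ ≤ hH.eigenvalues₀ i :=
      hH.eigenvalues₀_antitone (Fin.le_def.2 (by simp; omega))
    rw [hl', abs_le, neg_le]
    refine ⟨?_, h1.trans (le_max_left _ _)⟩
    exact ((neg_le_neg h2).trans (neg_le_abs _)).trans (le_max_right _ _)
  set e := (Fintype.equivOfCardEq (Fintype.card_fin (Fintype.card V)) :
    Fin (Fintype.card V) ≃ V) with he
  set j₀ : V := e ⟨0, by omega⟩ with hj₀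
  have hsmall' : ∀ j, j ≠ j₀ → |hH.eigenvalues j| ≤ l := by
    intro j hj
    refine hsmall (e.symm j) fun h => hj ?_
    rw [hj₀, ← e.symm_apply_eq]
    exact Fin.ext h
  set u := hH.eigenvectorBasis
  have hinner : ∀ (j : V) (y : V → ℝ), inner ℝ (u j) (WithLp.toLp 2 y) = ∑ v, u j v * y v := by
    intro j y
    simp [PiLp.inner_apply, mul_comm]
  have heig : ∀ j v, (transitionMatrix G d).mulVec (u j) v = hH.eigenvalues j * u j v := by
    intro j v
    rw [hH.mulVec_eigenvectorBasis j]
    simp [u]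
  have hcoef : ∀ (j : V) (y : V → ℝ),
      inner ℝ (u j) (WithLp.toLp 2 ((transitionMatrix G d).mulVec y)) =
        hH.eigenvalues j * inner ℝ (u j) (WithLp.toLp 2 y) := by
    intro j y
    rw [hinner, hinner, transitionMatrix_mulVec_comm, Finset.mul_sum]
    refine Finset.sum_congr rfl fun v _ => ?_
    rw [heig, mul_assoc]
  have hone : (transitionMatrix G d).mulVec (fun _ => 1) = fun _ => 1 :=
    funext (transitionMatrix_mulVec_one hd hG)
  -- The constant vector has eigenvalue `1`, while `|λ_j| ≤ l < 1` for `j ≠ j₀`.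
  have hortho : ∀ j, j ≠ j₀ → inner ℝ (u j) (WithLp.toLp 2 fun _ => (1 : ℝ)) = 0 := by
    intro j hj
    have h := hcoef j fun _ => 1
    rw [hone] at h
    have h1 : hH.eigenvalues j ≠ 1 := by
      intro h2
      have := hsmall' j hj
      rw [h2, abs_one] at this
      linarith
    have h3 : (1 - hH.eigenvalues j) * inner ℝ (u j) (WithLp.toLp 2 fun _ => (1 : ℝ)) = 0 := by
      linarith
    exact (mul_eq_zero.1 h3).resolve_left (sub_ne_zero.2 h1.symm)
  have hparseval : ∀ y : V → ℝ,
      ∑ j, inner ℝ (u j) (WithLp.toLp 2 y) ^ 2 = ∑ v, y v ^ 2 := by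
    intro y
    have h := u.sum_sq_norm_inner_right (WithLp.toLp 2 y)
    rw [EuclideanSpace.norm_sq_eq] at h
    simpa using h
  -- The constant vector is therefore a nonzero multiple of `u j₀`, and `x` is orthogonal to it.
  have hzero : inner ℝ (u j₀) (WithLp.toLp 2 x) = 0 := by
    have h := u.sum_inner_mul_inner (WithLp.toLp 2 fun _ => (1 : ℝ)) (WithLp.toLp 2 x)
    have h1 : inner ℝ (WithLp.toLp 2 fun _ : V => (1 : ℝ)) (WithLp.toLp 2 x) = 0 := by
      simpa [PiLp.inner_apply] using hx
    rw [h1, Finset.sum_eq_single j₀ (fun j _ hj => by rw [real_inner_comm, hortho j hj, zero_mul])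
      (by simp)] at h
    refine (mul_eq_zero.1 h).resolve_left fun h2 => ?_
    have h3 := hparseval fun _ => 1
    rw [Finset.sum_eq_zero fun j _ => ?_] at h3
    · simp only [one_pow, Finset.sum_const, Finset.card_univ, nsmul_eq_mul, mul_one] at h3
      have h4 : Fintype.card V = 0 := by exact_mod_cast h3.symm
      omega
    · by_cases hj : j = j₀
      · rw [hj, real_inner_comm, h2]; simp
      · rw [hortho j hj]; simp
  rw [← hparseval ((transitionMatrix G d).mulVec x), ← hparseval x, Finset.mul_sum]
  refine Finset.sum_le_sum fun j _ => ?_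
  rw [hcoef, mul_pow]
  by_cases hj : j = j₀
  · rw [hj, hzero]; simp
  · gcongr ?_ * _
    exact sq_le_sq' (by linarith [neg_abs_le (hH.eigenvalues j), hsmall' j hj])
      ((le_abs_self _).trans (hsmall' j hj))

theorem secondEigenvalue_nonneg (G : SimpleGraph V) (d : ℕ) : 0 ≤ secondEigenvalue G d := by
  unfold secondEigenvalue
  split_ifs
  · exact (abs_nonneg _).trans (le_max_right _ _)
  · exact le_rfl

/-- The expander mixing property. -/
theorem sum_sq_nbrFrac_sub_le {G : SimpleGraph V} {d : ℕ} (hd : 0 < d) (hG : IsDRegular G d)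
    (hV : 2 ≤ Fintype.card V) (hl : secondEigenvalue G d < 1) (B : Finset V) :
    ∑ v, (nbrFrac G d B v - (B.card : ℝ) / Fintype.card V) ^ 2 ≤
      secondEigenvalue G d ^ 2 * B.card := by
  classical
  have hn : (Fintype.card V : ℝ) ≠ 0 := by
    have : Fintype.card V ≠ 0 := by omega
    exact_mod_cast this
  have hd' : (d : ℝ) ≠ 0 := by positivity
  set b : ℝ := (B.card : ℝ) / Fintype.card V with hb
  have hbn : b * Fintype.card V = B.card := by rw [hb]; field_simp
  set x : V → ℝ := fun v => (if v ∈ B then 1 else 0) - b with hx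
  have hsum : ∑ v, (if v ∈ B then (1 : ℝ) else 0) = B.card := by simp
  have hx0 : ∑ v, x v = 0 := by
    simp only [hx, Finset.sum_sub_distrib, hsum, Finset.sum_const, Finset.card_univ, nsmul_eq_mul]
    linarith
  have h := sum_sq_transitionMatrix_mulVec_le hd hG hV hl hx0
  have hxs : ∑ v, x v ^ 2 ≤ B.card := by
    have : ∀ v, x v ^ 2 = (1 - 2 * b) * (if v ∈ B then (1 : ℝ) else 0) + b ^ 2 := by
      intro v
      simp only [hx]
      split_ifs <;> ring
    simp only [this, Finset.sum_add_distrib, ← Finset.mul_sum, hsum, Finset.sum_const,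
      Finset.card_univ, nsmul_eq_mul]
    have hb0 : 0 ≤ b := by positivity
    have : (0 : ℝ) ≤ b * B.card := by positivity
    nlinarith
  have hmul : ∀ v, (transitionMatrix G d).mulVec x v = nbrFrac G d B v - b := by
    intro v
    rw [transitionMatrix_mulVec, nbrFrac]
    simp only [hx, mul_sub, Finset.sum_sub_distrib, ← Finset.sum_mul, mul_ite, mul_one, mul_zero,
      (isDRegular_iff G d).1 hG, Finset.sum_ite_mem, Finset.univ_inter]
    field_simp
  simp only [hmul] at h
  exact h.trans (by gcongr)

theorem sum_sq_nbrFrac_le {G : SimpleGraph V} {d : ℕ} (hd : 0 < d) (hG : IsDRegular G d)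
    (hV : 2 ≤ Fintype.card V) (hl : secondEigenvalue G d < 1) (B : Finset V) :
    ∑ v, nbrFrac G d B v ^ 2 ≤
      (secondEigenvalue G d ^ 2 + (B.card : ℝ) / Fintype.card V) * B.card := by
  have hn : (Fintype.card V : ℝ) ≠ 0 := by
    have : Fintype.card V ≠ 0 := by omega
    exact_mod_cast this
  have h := sum_sq_nbrFrac_sub_le hd hG hV hl B
  set b : ℝ := (B.card : ℝ) / Fintype.card V with hb
  have hbn : b * Fintype.card V = B.card := by rw [hb]; field_simp
  have hpt : ∀ v, (nbrFrac G d B v - b) ^ 2 =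
      nbrFrac G d B v ^ 2 - 2 * b * nbrFrac G d B v + b ^ 2 := fun v => by ring
  simp only [hpt, Finset.sum_add_distrib, Finset.sum_sub_distrib, ← Finset.mul_sum,
    sum_nbrFrac hd hG, Finset.sum_const, Finset.card_univ, nsmul_eq_mul] at h
  have hb2 : (Fintype.card V : ℝ) * b ^ 2 = b * B.card := by rw [← hbn]; ring
  rw [hb2] at h
  linarith

/-- Cauchy–Schwarz turns the `ℓ²` bound into the `ℓ¹` bound. -/
theorem isMixing_secondEigenvalue {G : SimpleGraph V} {d : ℕ} (hd : 0 < d) (hG : IsDRegular G d)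
    (hV : 2 ≤ Fintype.card V) (hl : secondEigenvalue G d < 1) :
    IsMixing G d (secondEigenvalue G d) := by
  intro B
  have h := sum_sq_nbrFrac_sub_le hd hG hV hl B
  have hl0 := secondEigenvalue_nonneg G d
  refine abs_le_of_sq_le_sq' ?_ (by positivity) |>.2
  have hcs := sq_sum_le_card_mul_sum_sq (s := Finset.univ)
    (f := fun v => |nbrFrac G d B v - (B.card : ℝ) / Fintype.card V|)
  simp only [sq_abs, Finset.card_univ] at hcs
  have hB : (B.card : ℝ) ≤ Fintype.card V := by exact_mod_cast Finset.card_le_univ _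
  calc _ ≤ _ := hcs
    _ ≤ Fintype.card V * (secondEigenvalue G d ^ 2 * Fintype.card V) := by
        gcongr
        exact h.trans (by gcongr)
    _ = _ := by ring

/-- The constants fit since `1/32² + 1/512 = 3/1024 < 1/256`. -/
theorem isSpreading_of_secondEigenvalue {G : SimpleGraph V} {d : ℕ} (hd : 0 < d)
    (hG : IsDRegular G d) (hV : 2 ≤ Fintype.card V) (hl : secondEigenvalue G d ≤ 1 / 32) :
    IsSpreading G d (1 / 512) := by
  intro B hB
  have hn : (0 : ℝ) < Fintype.card V := by
    have : 0 < Fintype.card V := by omega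
    exact_mod_cast this
  refine (sum_sq_nbrFrac_le hd hG hV (by linarith) B).trans ?_
  have h1 : secondEigenvalue G d ^ 2 ≤ (1 / 32) ^ 2 :=
    pow_le_pow_left₀ (secondEigenvalue_nonneg G d) hl 2
  have h2 : (B.card : ℝ) / Fintype.card V ≤ 1 / 512 := by rwa [div_le_iff₀ hn]
  have h3 : (0 : ℝ) ≤ B.card := Nat.cast_nonneg _
  nlinarith

/-- The second-moment bound for a single vertex `v`, whose left side is exactly `1/d`. It shows that
a small second eigenvalue forces a large degree, which controls the error `2/d`. -/
theorem inv_degree_le {G : SimpleGraph V} {d : ℕ} (hd : 0 < d) (hG : IsDRegular G d)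
    (hV : 2 ≤ Fintype.card V) (hl : secondEigenvalue G d < 1) :
    1 / (d : ℝ) ≤ secondEigenvalue G d ^ 2 + 1 / Fintype.card V := by
  have : Nonempty V := Fintype.card_pos_iff.1 (by omega)
  have v : V := Classical.arbitrary V
  have h := sum_sq_nbrFrac_le hd hG hV hl {v}
  have hd' : (d : ℝ) ≠ 0 := by positivity
  have hsq : ∀ w, adjInd G w v ^ 2 = adjInd G v w := by
    intro w
    rw [adjInd_comm]
    unfold adjInd
    split_ifs <;> norm_num
  simp only [nbrFrac, Finset.sum_singleton, Finset.card_singleton, div_pow, hsq, ← Finset.sum_div,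
    (isDRegular_iff G d).1 hG] at h
  rw [sq (d : ℝ), div_self_mul_self'] at h
  simpa using h
end

/-! ### Asymptotics and choice of the constants. -/

theorem tendsto_failBound {θ : ℝ} (hθ : 0 < θ) {n : ℕ → ℕ} {ν : ℕ → ℝ}
    (hn : Tendsto n atTop atTop) (hν : Tendsto (fun k => ν k * √(n k : ℝ)) atTop atTop) :
    Tendsto (fun k => failBound θ (n k) (ν k)) atTop (𝓝 0) := by
  have hn' : Tendsto (fun k => (n k : ℝ)) atTop atTop := tendsto_natCast_atTop_atTop.comp hn
  have h1 : Tendsto (fun k => 8 / (θ / 32) ^ 3 / (ν k ^ 2 * n k)) atTop (𝓝 0) := by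
    refine Tendsto.const_div_atTop ?_ _
    refine ((tendsto_pow_atTop (two_ne_zero)).comp hν).congr fun k => ?_
    simp [mul_pow]
  have h2 : Tendsto (fun k => 1 / (n k : ℝ)) atTop (𝓝 0) := tendsto_const_nhds.div_atTop hn'
  have h3 : Tendsto (fun x : ℝ => Real.log x * Real.exp (-(θ ^ 2 * x / 64))) atTop (𝓝 0) := by
    set c := θ ^ 2 / 64 with hc
    have hc0 : 0 < c := by positivity
    have h4 : Tendsto (fun x : ℝ => c⁻¹ * ((c * x) ^ 1 * Real.exp (-(c * x)))) atTop
        (𝓝 (c⁻¹ * 0)) :=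
      ((Real.tendsto_pow_mul_exp_neg_atTop_nhds_zero 1).comp
        (tendsto_id.const_mul_atTop hc0)).const_mul _
    rw [mul_zero] at h4
    refine tendsto_of_tendsto_of_tendsto_of_le_of_le' tendsto_const_nhds h4 ?_ ?_
    · filter_upwards [eventually_ge_atTop 1] with x hx
      exact mul_nonneg (Real.log_nonneg hx) (Real.exp_pos _).le
    · filter_upwards [eventually_ge_atTop 1] with x hx
      have e1 : θ ^ 2 * x / 64 = c * x := by rw [hc]; ring
      have e2 : c⁻¹ * ((c * x) ^ 1 * Real.exp (-(c * x))) = x * Real.exp (-(c * x)) := by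
        field_simp
      rw [e1, e2]
      gcongr
      exact Real.log_le_self (by linarith)
  have h5 := (h3.comp hn').const_mul (timeFactor (θ / 32))
  have h6 := h1.add (h2.add h5)
  simp only [mul_zero, add_zero] at h6
  refine h6.congr fun k => ?_
  simp only [failBound, Function.comp_apply, mul_assoc]

theorem eventually_small_corruption {n f : ℕ → ℕ} {ν : ℕ → ℝ} (hν : ∀ k, 0 ≤ ν k)
    (hf : (fun k => (f k : ℝ)) =o[atTop] (fun k => ν k * (n k : ℝ))) {κ : ℝ} (hκ : 0 < κ) :
    ∀ᶠ k in atTop, (f k : ℝ) ≤ κ * ν k * n k := by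
  filter_upwards [hf.def hκ] with k hk
  have h := mul_nonneg (hν k) (Nat.cast_nonneg (n k) : (0 : ℝ) ≤ n k)
  rw [Real.norm_of_nonneg (Nat.cast_nonneg _), Real.norm_of_nonneg h] at hk
  linarith

/-- One constant `C` serves for the time and for the number of exceptions; the latter only needs `C
≥ 1`. -/
theorem corruption_le_timeFactor_mul {κ : ℝ} (hκ : 0 < κ) (f : ℕ) :
    (f : ℝ) ≤ timeFactor κ * f :=
  le_mul_of_one_le_left (Nat.cast_nonneg _) (one_le_timeFactor hκ)

theorem eventually_log_ge {n : ℕ → ℕ} (hn : Tendsto n atTop atTop) :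
    ∀ᶠ k in atTop, 3 ≤ Real.log (n k) :=
  (Real.tendsto_log_atTop.comp (tendsto_natCast_atTop_atTop.comp hn)).eventually_ge_atTop 3

theorem expander_voting :
    ∃ K > (0 : ℝ), ∃ C > (0 : ℝ), ∀ (s : Sampling) (n d f : ℕ → ℕ)
      (G : ∀ k, SimpleGraph (Fin (n k)))
      (A₀ : ∀ k, Finset (Fin (n k)))
      (σ : ∀ k, Adversary (Fin (n k)) (f k)),
      Tendsto n atTop atTop →
      (∀ k, 1 ≤ d k) →
      (∀ k, IsDRegular (G k) (d k)) →
      (∀ k, K * secondEigenvalue (G k) (d k) ≤ imbalance (A₀ k)) →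
      Tendsto (fun k => imbalance (A₀ k) * √(n k : ℝ)) atTop atTop →
      (fun k => (f k : ℝ)) =o[atTop] (fun k => imbalance (A₀ k) * (n k : ℝ)) →
      Tendsto (fun k =>
        (votingRun s (G k) (σ k) (A₀ k) ⌊C * Real.log (n k)⌋₊).toOuterMeasure
          (almostAllAdopted (C * (f k : ℝ)))) atTop (𝓝 1) := by
  obtain ⟨θ, hθ⟩ : ∃ θ : ℝ, θ = 1 / 512 := ⟨_, rfl⟩
  obtain ⟨κ, hκ⟩ : ∃ κ : ℝ, κ = θ / 32 := ⟨_, rfl⟩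
  have hκ0 : 0 < κ := by norm_num [hκ, hθ]
  have hκ1 : κ ≤ 1 / 16384 := by norm_num [hκ, hθ]
  refine ⟨2 / κ, by positivity, timeFactor κ, by linarith [one_le_timeFactor hκ0], ?_⟩
  intro s n d f G A₀ σ hn hd hG hK hν hf
  have hν0 : ∀ k, 0 ≤ imbalance (A₀ k) := fun k =>
    (mul_nonneg (by positivity) (secondEigenvalue_nonneg _ _)).trans (hK k)
  refine PMF.tendsto_toOuterMeasure_one _ _ (tendsto_failBound (θ := θ) (by norm_num [hθ]) hn hν) ?_
  filter_upwards [eventually_log_ge hn, hν.eventually_ge_atTop (2 / κ),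
    eventually_small_corruption hν0 hf hκ0, hn.eventually_ge_atTop 2] with k h1 h2 h3 h4
  refine (votingRun_compl_le s (G k) (σ k) _ (A₀ k) _).trans (ENNReal.ofReal_le_ofReal ?_)
  have hV : 2 ≤ Fintype.card (Fin (n k)) := by rwa [Fintype.card_fin]
  have hn2 : (2 : ℝ) ≤ n k := by exact_mod_cast h4
  have hl0 := secondEigenvalue_nonneg (G k) (d k)
  have hν1 := imbalance_le_one (A₀ k)
  have hKk := hK k
  set l := secondEigenvalue (G k) (d k) with hl
  set ν := imbalance (A₀ k)
  have hlν : l ≤ κ / 2 * ν := by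
    rw [div_mul_eq_mul_div, div_le_iff₀ hκ0] at hKk
    linarith
  have hl1 : l ≤ 1 / 32 := by nlinarith
  have hdeg := inv_degree_le (hd k) (hG k) hV (by linarith)
  rw [Fintype.card_fin, ← hl] at hdeg
  have hsq : √(n k : ℝ) * √(n k : ℝ) = n k := Real.mul_self_sqrt (by linarith)
  have hs1 : 1 ≤ √(n k : ℝ) := Real.one_le_sqrt.2 (by linarith)
  have hνn : 1 / (n k : ℝ) ≤ κ / 2 * ν := by
    rw [div_le_iff₀ hκ0] at h2
    rw [div_le_iff₀ (by linarith), ← hsq]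
    have : ν * √(n k : ℝ) * κ ≤ ν * √(n k : ℝ) * κ * √(n k : ℝ) :=
      le_mul_of_one_le_right (by linarith) hs1
    nlinarith
  -- Half of `κ * ν` covers `l ^ 2 ≤ l`, the other half `1/n`.
  have hdκ : 1 / (d k : ℝ) ≤ κ * ν := by nlinarith
  have hd2 : 2 ≤ d k := by
    have hd0 : (0 : ℝ) < d k := by exact_mod_cast hd k
    have : (1 : ℝ) < d k := by
      by_contra hcon
      have h5 : 1 ≤ 1 / (d k : ℝ) := by rw [le_div_iff₀ hd0]; linarith
      nlinarith
    exact_mod_cast this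
  have hone : (1 : ℝ) ≤ 2 / κ := by rw [le_div_iff₀ hκ0]; linarith
  have key := failProb_le_failBound s hd2 (hG k) (σ k) (m := timeFactor κ * f k) (θ := θ) (ε := l)
    (corruption_le_timeFactor_mul hκ0 _) (by norm_num [hθ]) (by norm_num [hθ])
    (by rw [hθ]; exact isSpreading_of_secondEigenvalue (hd k) (hG k) hV hl1)
    (isMixing_secondEigenvalue (hd k) (hG k) hV (by linarith)) (A₀ := A₀ k)
    (by rwa [Fintype.card_fin]) (by rw [Fintype.card_fin]; exact hone.trans h2)
    (by rw [← hκ]; nlinarith) (by rw [← hκ]; exact hdκ)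
    (by rw [Fintype.card_fin, ← hκ]; exact h3)
  rwa [Fintype.card_fin, ← hκ] at key

theorem random_regular_voting :
    ∃ K > (0 : ℝ), ∃ C > (0 : ℝ), ∀ (s : Sampling) (n d f : ℕ → ℕ) (ν₀ : ℕ → ℝ)
      (A₀ : ∀ k, SimpleGraph (Fin (n k)) → Finset (Fin (n k)))
      (σ : ∀ k, SimpleGraph (Fin (n k)) → Adversary (Fin (n k)) (f k))
      (hne : ∀ k, (regularGraphs (n k) (d k)).Nonempty),
      Tendsto n atTop atTop →
      (∀ k, 1 ≤ d k) →
      (∀ k, ∀ G ∈ regularGraphs (n k) (d k), imbalance (A₀ k G) = ν₀ k) →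
      (∀ k, K * √((d k : ℝ) / (n k : ℝ) + 1 / (d k : ℝ)) ≤ ν₀ k) →
      (fun k => (f k : ℝ)) =o[atTop] (fun k => ν₀ k * (n k : ℝ)) →
      Tendsto (fun k =>
        ((PMF.uniformOfFinset (regularGraphs (n k) (d k)) (hne k)).bind fun G =>
          votingRun s G (σ k G) (A₀ k G) ⌊C * Real.log (n k)⌋₊).toOuterMeasure
            (almostAllAdopted (C * (f k : ℝ)))) atTop (𝓝 1) := by
  classical
  obtain ⟨η, hη⟩ : ∃ η : ℝ, η = 1 / (512 * 513) := ⟨_, rfl⟩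
  have hη0 : 0 < η := by rw [hη]; norm_num
  have hη1 : η ≤ 1 := by rw [hη]; norm_num
  obtain ⟨θ, hθ⟩ : ∃ θ : ℝ, θ = Real.exp (-(4 / η)) / 513 := ⟨_, rfl⟩
  have hθ0 : 0 < θ := by rw [hθ]; positivity
  have hθ1 : θ ≤ 1 := by
    have : Real.exp (-(4 / η)) ≤ 1 := Real.exp_le_one_iff.2 (by
      have : 0 ≤ 4 / η := by positivity
      linarith)
    rw [hθ]
    linarith
  obtain ⟨κ, hκ⟩ : ∃ κ : ℝ, κ = θ / 32 := ⟨_, rfl⟩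
  have hκ0 : 0 < κ := by rw [hκ]; positivity
  have hκ1 : κ ≤ 1 := by rw [hκ]; linarith
  -- With `D = √(d/n + 1/d)`, the mixing error is at most `20(D² + D) ≤ 40D`, which `40/κ` handles;
  -- `32/η` ensures `η * d ≥ 32` for sparseness.
  obtain ⟨K, hK⟩ : ∃ K : ℝ, K = 40 / κ + 32 / η := ⟨_, rfl⟩
  have hK40 : 40 / κ ≤ K := by
    have : 0 < 32 / η := by positivity
    linarith
  have hK32 : 32 / η ≤ K := by
    have : 0 < 40 / κ := by positivity
    linarith
  have hK8 : 40 ≤ K := by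
    refine le_trans ?_ hK40
    rw [le_div_iff₀ hκ0]
    linarith
  refine ⟨K, by linarith, timeFactor κ, by linarith [one_le_timeFactor hκ0], ?_⟩
  intro s n d f ν₀ A₀ σ hne hn hd hA hKν hf
  have hν0 : ∀ k, 0 ≤ ν₀ k := fun k => (mul_nonneg (by linarith) (Real.sqrt_nonneg _)).trans (hKν k)
  have hn' : Tendsto (fun k => (n k : ℝ)) atTop atTop := tendsto_natCast_atTop_atTop.comp hn
  -- Here `ν₀√n ≥ √(d + n/d)`, and `d + n/d ≥ √n` for every `d`, so `ν₀√n ≥ n^(1/4)`.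
  have hν : Tendsto (fun k => ν₀ k * √(n k : ℝ)) atTop atTop := by
    refine tendsto_atTop_mono' _ ?_
      (Real.tendsto_sqrt_atTop.comp (Real.tendsto_sqrt_atTop.comp hn'))
    filter_upwards [hn.eventually_ge_atTop 1] with k hk
    have hn0 : (0 : ℝ) < n k := by exact_mod_cast hk
    have hd0 : (0 : ℝ) < d k := by exact_mod_cast hd k
    have h1 : √((d k : ℝ) / n k + 1 / d k) ≤ ν₀ k :=
      (le_mul_of_one_le_left (Real.sqrt_nonneg _) (by linarith)).trans (hKν k)
    refine le_trans ?_ (mul_le_mul_of_nonneg_right h1 (Real.sqrt_nonneg _))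
    rw [← Real.sqrt_mul (by positivity)]
    refine Real.sqrt_le_sqrt ?_
    have h2 : ((d k : ℝ) / n k + 1 / d k) * n k = (d k ^ 2 + n k) / d k := by field_simp
    simp only [Function.comp_apply]
    rw [h2, le_div_iff₀ hd0]
    nlinarith [sq_nonneg ((d k : ℝ) - √(n k : ℝ)), Real.sq_sqrt hn0.le,
      mul_nonneg (Real.sqrt_nonneg (n k : ℝ)) hd0.le]
  have hgraph : Tendsto (fun k => (4 * Real.exp (-2)) ^ n k + 4 / (n k : ℝ)) atTop (𝓝 0) := by
    have h1 : 4 * Real.exp (-2) < 1 := by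
      rw [Real.exp_neg, ← div_eq_mul_inv, div_lt_one (Real.exp_pos _)]
      have := Real.quadratic_le_exp_of_nonneg (x := 2) (by norm_num)
      linarith
    have h2 := (tendsto_pow_atTop_nhds_zero_of_lt_one (by positivity) h1).comp hn
    have h3 := h2.add ((tendsto_const_nhds (x := (4 : ℝ))).div_atTop hn')
    simpa using h3
  have hlim := (tendsto_failBound hθ0 hn hν).add hgraph
  rw [add_zero] at hlim
  refine PMF.tendsto_toOuterMeasure_one _ _ hlim ?_
  filter_upwards [eventually_log_ge hn, hν.eventually_ge_atTop 1,
    eventually_small_corruption hν0 hf hκ0, hn.eventually_ge_atTop 2] with k h1 h2 h3 h4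
  obtain ⟨G₀, hG₀⟩ := hne k
  have hν1 : ν₀ k ≤ 1 := hA k G₀ hG₀ ▸ imbalance_le_one _
  have hn2 : (2 : ℝ) ≤ n k := by exact_mod_cast h4
  have hd0 : (0 : ℝ) < d k := by exact_mod_cast hd k
  set D := √((d k : ℝ) / n k + 1 / d k) with hD
  have hD0 : 0 ≤ D := Real.sqrt_nonneg _
  have hdn : 0 ≤ (d k : ℝ) / n k := by positivity
  have hd1 : 0 ≤ 1 / (d k : ℝ) := by positivity
  have hDsq : D ^ 2 = (d k : ℝ) / n k + 1 / d k := Real.sq_sqrt (by positivity)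
  have hKD : K * D ≤ 1 := (hKν k).trans hν1
  have hD1 : D ≤ 1 := by nlinarith
  have hDD : D ^ 2 ≤ D := by nlinarith
  have hκD : 40 * D ≤ κ * ν₀ k := by
    have h5 : 40 / κ * D ≤ ν₀ k := (mul_le_mul_of_nonneg_right hK40 hD0).trans (hKν k)
    rw [div_mul_eq_mul_div, div_le_iff₀ hκ0] at h5
    linarith
  have hDsmall : K * D ^ 2 ≤ 1 := by nlinarith
  -- From `K * D² ≤ 1`, each of the two summands of `D²` is at most `1/K`, which confines `d` to `K
  -- ≤ d ≤ n/K`.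
  have hdK : K ≤ d k := by
    have h5 : K * (1 / d k) ≤ 1 := by nlinarith
    rw [mul_one_div, div_le_one hd0] at h5
    exact h5
  have hnK : K * d k ≤ n k := by
    have h5 : K * (d k / n k) ≤ 1 := by nlinarith
    rw [← mul_div_assoc, div_le_one (by linarith)] at h5
    exact h5
  have hd4 : 40 ≤ d k := by
    have : (40 : ℝ) ≤ d k := by linarith
    exact_mod_cast this
  have hdn4 : 4 * (d k + 1) ≤ n k := by
    have : 4 * ((d k : ℝ) + 1) ≤ n k := by nlinarith
    exact_mod_cast this
  have hηd : 32 ≤ η * d k := by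
    rw [← div_le_iff₀' hη0]
    linarith
  set ε := 20 * ((d k : ℝ) / n k + 1 / √(d k : ℝ)) with hε
  have hεκ : ε ≤ κ * ν₀ k := by
    have h5 : 1 / √(d k : ℝ) ≤ D := by
      rw [← Real.sqrt_one, ← Real.sqrt_div (by norm_num)]
      exact Real.sqrt_le_sqrt (by linarith)
    rw [hε]
    linarith
  have hdκ : 1 / (d k : ℝ) ≤ κ * ν₀ k := by linarith
  set R := regularGraphs (n k) (d k) with hR
  refine PMF.uniformOfFinset_bind_le R
    ((R.filter fun G => ¬ IsMixing G (d k) ε) ∪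
      (R.filter fun G => ¬ IsSparse G (d k) (Real.exp (-(4 / η))) η)) (hne k) _ _ ?_ ?_ ?_
  · have := one_le_timeFactor (κ := θ / 32) (by positivity)
    unfold failBound
    positivity
  · have hm := card_not_isMixing_le (n := n k) (d := d k) (by omega) hdn4
    have hs := card_not_isSparse_le (n := n k) (d := d k) hη0 hη1 hηd hdn4
    have hu := Finset.card_union_le (R.filter fun G => ¬ IsMixing G (d k) ε)
      (R.filter fun G => ¬ IsSparse G (d k) (Real.exp (-(4 / η))) η)
    have hu' : (((R.filter fun G => ¬ IsMixing G (d k) ε) ∪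
        (R.filter fun G => ¬ IsSparse G (d k) (Real.exp (-(4 / η))) η)).card : ℝ) ≤
        (R.filter fun G => ¬ IsMixing G (d k) ε).card +
          (R.filter fun G => ¬ IsSparse G (d k) (Real.exp (-(4 / η))) η).card := by
      exact_mod_cast hu
    refine hu'.trans ?_
    rw [mul_add]
    exact add_le_add (by convert hm) (by convert hs)
  · intro G hGR hbad
    simp only [Finset.mem_union, Finset.mem_filter, hGR, true_and, not_or, not_not] at hbad
    have hG : IsDRegular G (d k) := mem_regularGraphs.1 hGR
    refine (votingRun_compl_le s G (σ k G) _ (A₀ k G) _).trans (ENNReal.ofReal_le_ofReal ?_)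
    have hS : IsSpreading G (d k) θ := by
      rw [hθ]
      refine IsSparse.isSpreading (by omega) hG ?_
      rw [← hη]
      exact hbad.2
    have key := failProb_le_failBound s (by omega : 2 ≤ d k) hG (σ k G)
      (m := timeFactor κ * f k) (θ := θ) (ε := ε)
      (corruption_le_timeFactor_mul hκ0 _) hθ0 hθ1 hS hbad.1 (A₀ := A₀ k G)
      (by rwa [Fintype.card_fin]) (by rw [Fintype.card_fin, hA k G hGR]; exact h2)
      (by rw [← hκ, hA k G hGR]; exact hεκ) (by rw [← hκ, hA k G hGR]; exact hdκ)
      (by rw [← hκ, hA k G hGR, Fintype.card_fin]; exact h3)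
    rw [Fintype.card_fin, hA k G hGR, ← hκ] at key
    exact key

theorem mainTheorem10 :
    -- random regular graphs
    (∃ K > (0 : ℝ), ∃ C > (0 : ℝ), ∀ (s : Sampling) (n d f : ℕ → ℕ) (ν₀ : ℕ → ℝ)
      (A₀ : ∀ k, SimpleGraph (Fin (n k)) → Finset (Fin (n k)))
      (σ : ∀ k, SimpleGraph (Fin (n k)) → Adversary (Fin (n k)) (f k))
      (hne : ∀ k, (regularGraphs (n k) (d k)).Nonempty),
      Tendsto n atTop atTop →
      (∀ k, 1 ≤ d k) →
      (∀ k, ∀ G ∈ regularGraphs (n k) (d k), imbalance (A₀ k G) = ν₀ k) →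
      (∀ k, K * √((d k : ℝ) / (n k : ℝ) + 1 / (d k : ℝ)) ≤ ν₀ k) →
      (fun k => (f k : ℝ)) =o[atTop] (fun k => ν₀ k * (n k : ℝ)) →
      Tendsto (fun k =>
        ((PMF.uniformOfFinset (regularGraphs (n k) (d k)) (hne k)).bind fun G =>
          votingRun s G (σ k G) (A₀ k G) ⌊C * Real.log (n k)⌋₊).toOuterMeasure
            (almostAllAdopted (C * (f k : ℝ)))) atTop (𝓝 1)) ∧
    -- expanders
    (∃ K > (0 : ℝ), ∃ C > (0 : ℝ), ∀ (s : Sampling) (n d f : ℕ → ℕ)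
      (G : ∀ k, SimpleGraph (Fin (n k)))
      (A₀ : ∀ k, Finset (Fin (n k)))
      (σ : ∀ k, Adversary (Fin (n k)) (f k)),
      Tendsto n atTop atTop →
      (∀ k, 1 ≤ d k) →
      (∀ k, IsDRegular (G k) (d k)) →
      (∀ k, K * secondEigenvalue (G k) (d k) ≤ imbalance (A₀ k)) →
      Tendsto (fun k => imbalance (A₀ k) * √(n k : ℝ)) atTop atTop →
      (fun k => (f k : ℝ)) =o[atTop] (fun k => imbalance (A₀ k) * (n k : ℝ)) →
      Tendsto (fun k =>
        (votingRun s (G k) (σ k) (A₀ k) ⌊C * Real.log (n k)⌋₊).toOuterMeasure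
          (almostAllAdopted (C * (f k : ℝ)))) atTop (𝓝 1)) := by
  exact ⟨random_regular_voting, expander_voting⟩
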